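/- Let $\mathbb D$ be the open unit disc of $\mathbb C$ and let $H(\mathbb D)$ be the space of holomorphic functions on $\mathbb D$ with the topology of uniform convergence on compact sets; a function $f(z)=\sum_{n\ge 0}a_nz^n$ in $H(\mathbb D)$ is identified with the sequence $(a_n)_{n\ge 0}$. For $\gamma>0$ let $$H^\infty_{v_\gamma}=\Big\{f\in H(\mathbb D):\ \sup_{z\in\mathbb D}(1-|z|)^\gamma|f(z)|<\infty\Big\},$$ let $S(H^\infty_{v_\gamma})$ (the solid hull) be the set of all $(c_n)_n$ for which there is $(a_n)_n\in H^\infty_{v_\gamma}$ with $|c_n|\le|a_n|$ for all $n\ge 0$, and let $s(H^\infty_{v_\gamma})$ (the solid core) be the set of all $(c_n)_n$ such that $(c_nb_n)_n\in H^\infty_{v_\gamma}$ for every bounded complex sequence $(b_n)_n$. They are endowed with the norms $$\|(a_m)_m\|_{S(H^\infty_{v_\gamma})}=\max\Big\{|a_0|,\ \sup_{n\ge 0}\Big(\sum_{m=2^n}^{2^{n+1}-1}\frac{|a_m|^2}{(m+1)^{2\gamma}}\Big)^{1/2}\Big\},\qquad \|(a_m)_m\|_{s(H^\infty_{v_\gamma})}=\max\Big\{|a_0|,\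 \sup_{n\ge 0}\sum_{m=2^n}^{2^{n+1}-1}\frac{|a_m|}{(m+1)^{\gamma}}\Big\}.$$ Let $s>0$ and let $\mu$ be a positive finite Borel measure on $[0,1)$ that is an $s$-Carleson measure, that is, $\mu([t,1))=O((1-t)^s)$ as $t\to1^-$. Let $\mu_n=\int_{[0,1)}t^n\,d\mu(t)$, and for $f(z)=\sum_{n\ge 0} a_nz^n$ in $H(\mathbb D)$ put $$H_\mu(f)(z)=\sum_{n=0}^\infty\Big(\sum_{k=0}^\infty\mu_{n+k}a_k\Big)z^n,\qquad I_\mu(f)(z)=\int_{[0,1)}\frac{f(t)}{1-tz}\,d\mu(t),\qquad z\in\mathbb D,$$ whenever the series, respectively the integrals, converge and define a holomorphic function on $\mathbb D$. (i) If $s>\gamma+\frac12$, then $H_\mu$ and $I_\mu$ are well defined on $S(H^\infty_{v_\gamma})$ (the series $\sum_k\mu_{n+k}a_k$ and the integrals converging absolutely), $H_\mu=I_\mu$ on $S(H^\infty_{v_\gamma})$, and $H_\mu:S(H^\infty_{v_\gamma})\to H(\mathbb D)$ is linear and continuous. If in addition $\gamma\ge\frac12$, then $H_\mu$ maps $S(H^\infty_{v_\gamma})$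 into itself and $H_\mu:S(H^\infty_{v_\gamma})\to S(H^\infty_{v_\gamma})$ is continuous. (ii) If $s>\gamma$, then $H_\mu$ and $I_\mu$ are well defined on $s(H^\infty_{v_\gamma})$ (with absolute convergence as in (i)), $H_\mu=I_\mu$ on $s(H^\infty_{v_\gamma})$, and $H_\mu:s(H^\infty_{v_\gamma})\to H(\mathbb D)$ is linear and continuous. If in addition $\gamma\ge1$, then $H_\mu$ maps $s(H^\infty_{v_\gamma})$ into itself and $H_\mu:s(H^\infty_{v_\gamma})\to s(H^\infty_{v_\gamma})$ is continuous. -/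

import Mathlib

open MeasureTheory Filter Topology
open scoped ENNReal

noncomputable section

namespace HilbertOp

/-- The open unit disc `𝔻` of `ℂ`. -/
abbrev Disc : Type := Metric.ball (0 : ℂ) 1

/-- The half-open interval `[0,1)`. -/
abbrev Interval : Type := Set.Ico (0 : ℝ) 1

/-- The inclusion of `[0,1)` into the unit disc. -/
def Interval.toDisc (t : Interval) : Disc :=
  ⟨((t : ℝ) : ℂ), by
    have h0 := t.2.1
    have h1 := t.2.2
    simpa [Metric.mem_ball, abs_of_nonneg h0] using h1⟩

/-- The space `H(𝔻)` of holomorphic functions on the disc. As a subspace of `C(𝔻, ℂ)` with the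
compact-open topology, it carries the topology of uniform convergence on compact sets. -/
def HolDisc : Submodule ℂ C(Disc, ℂ) where
  carrier := {f | ∃ F : ℂ → ℂ, DifferentiableOn ℂ F (Metric.ball 0 1) ∧ ∀ z : Disc, f z = F z}
  add_mem' := by
    rintro f g ⟨F, hF, hf⟩ ⟨G, hG, hg⟩
    exact ⟨F + G, hF.add hG, fun z => by simp [hf, hg]⟩
  zero_mem' := ⟨0, differentiableOn_const 0, fun z => by simp⟩
  smul_mem' := by
    rintro c f ⟨F, hF, hf⟩
    exact ⟨c • F, hF.const_smul c, fun z => by simp [hf]⟩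

/-- The `n`-th Taylor coefficient at `0` of a holomorphic function on the disc (the function is
extended by `0` outside of the disc, which does not affect the derivatives at `0`). -/
def coeff (f : HolDisc) (n : ℕ) : ℂ :=
  iteratedDeriv n (Function.extend Subtype.val (fun z : Disc => f.1 z) 0) 0 / (n.factorial : ℂ)

/-- The weighted space `H^∞_{v_γ}`, with `v_γ(z) = (1 - |z|)^γ`. -/
def weightedSpace (γ : ℝ) : Set HolDisc :=
  {f | BddAbove (Set.range fun z : Disc => (1 - ‖(z : ℂ)‖) ^ γ * ‖f.1 z‖)}

/-- `H^∞_{v_γ}` as a space of sequences, a function being identified with its sequence of Taylor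
coefficients. -/
def weightedSeq (γ : ℝ) : Set (ℕ → ℂ) := coeff '' weightedSpace γ

/-- The solid hull of a space of sequences. -/
def solidHull (A : Set (ℕ → ℂ)) : Set (ℕ → ℂ) := {c | ∃ a ∈ A, ∀ n, ‖c n‖ ≤ ‖a n‖}

/-- The solid core of a space of sequences. -/
def solidCore (A : Set (ℕ → ℂ)) : Set (ℕ → ℂ) :=
  {c | ∀ b : ℕ → ℂ, Memℓp b ∞ → (fun n => c n * b n) ∈ A}

/-- The norm of the solid hull, as an extended real: the supremum over the blocks
`{0}` and `{2^n, …, 2^(n+1) - 1}`, `n ≥ 0`, of the weighted `ℓ²`-norms. -/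
def hullNorm (γ : ℝ) (a : ℕ → ℂ) : ℝ≥0∞ :=
  ENNReal.ofReal ‖a 0‖ ⊔
    ⨆ n : ℕ, ENNReal.ofReal
      (√(∑ m ∈ Finset.Ico (2 ^ n) (2 ^ (n + 1)), ‖a m‖ ^ 2 / ((m : ℝ) + 1) ^ (2 * γ)))

/-- The norm of the solid core, as an extended real: the supremum over the blocks
`{0}` and `{2^n, …, 2^(n+1) - 1}`, `n ≥ 0`, of the weighted `ℓ¹`-norms. -/
def coreNorm (γ : ℝ) (a : ℕ → ℂ) : ℝ≥0∞ :=
  ENNReal.ofReal ‖a 0‖ ⊔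
    ⨆ n : ℕ, ENNReal.ofReal
      (∑ m ∈ Finset.Ico (2 ^ n) (2 ^ (n + 1)), ‖a m‖ / ((m : ℝ) + 1) ^ γ)

theorem hullNorm_neg (γ : ℝ) (a : ℕ → ℂ) : hullNorm γ (-a) = hullNorm γ a := by
  simp [hullNorm]

theorem coreNorm_neg (γ : ℝ) (a : ℕ → ℂ) : coreNorm γ (-a) = coreNorm γ a := by
  simp [coreNorm]

theorem hullNorm_zero (γ : ℝ) : hullNorm γ 0 = 0 := by
  simp [hullNorm]

theorem coreNorm_zero (γ : ℝ) : coreNorm γ 0 = 0 := by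
  simp [coreNorm]

theorem coreNorm_add (γ : ℝ) (a b : ℕ → ℂ) :
    coreNorm γ (a + b) ≤ coreNorm γ a + coreNorm γ b := by
  refine sup_le ?_ (iSup_le fun n => ?_)
  · refine le_trans ?_ (add_le_add le_sup_left le_sup_left)
    rw [← ENNReal.ofReal_add (norm_nonneg _) (norm_nonneg _)]
    exact ENNReal.ofReal_le_ofReal (norm_add_le _ _)
  · refine le_trans ?_ (add_le_add
      (le_trans (le_iSup (fun n : ℕ => ENNReal.ofReal
        (∑ m ∈ Finset.Ico (2 ^ n) (2 ^ (n + 1)), ‖a m‖ / ((m : ℝ) + 1) ^ γ)) n) le_sup_right)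
      (le_trans (le_iSup (fun n : ℕ => ENNReal.ofReal
        (∑ m ∈ Finset.Ico (2 ^ n) (2 ^ (n + 1)), ‖b m‖ / ((m : ℝ) + 1) ^ γ)) n) le_sup_right))
    rw [← ENNReal.ofReal_add (Finset.sum_nonneg fun _ _ => by positivity)
      (Finset.sum_nonneg fun _ _ => by positivity), ← Finset.sum_add_distrib]
    refine ENNReal.ofReal_le_ofReal (Finset.sum_le_sum fun m _ => ?_)
    rw [← add_div]
    exact div_le_div_of_nonneg_right (norm_add_le _ _) (by positivity)

theorem sqrt_block_add (γ : ℝ) (a b : ℕ → ℂ) (F : Finset ℕ) :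
    √(∑ m ∈ F, ‖(a + b) m‖ ^ 2 / ((m : ℝ) + 1) ^ (2 * γ)) ≤
      √(∑ m ∈ F, ‖a m‖ ^ 2 / ((m : ℝ) + 1) ^ (2 * γ)) +
        √(∑ m ∈ F, ‖b m‖ ^ 2 / ((m : ℝ) + 1) ^ (2 * γ)) := by
  have key : ∀ c : ℕ → ℂ, ∑ m ∈ F, ‖c m‖ ^ 2 / ((m : ℝ) + 1) ^ (2 * γ) =
      ∑ m ∈ F, (‖c m‖ / ((m : ℝ) + 1) ^ γ) ^ 2 := fun c =>
    Finset.sum_congr rfl fun m _ => by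
      rw [div_pow, mul_comm 2 γ, Real.rpow_mul (by positivity), Real.rpow_two]
  rw [key, key, key]
  have h := Real.Lp_add_le_of_nonneg F (p := 2) (f := fun m => ‖a m‖ / ((m : ℝ) + 1) ^ γ)
    (g := fun m => ‖b m‖ / ((m : ℝ) + 1) ^ γ) (by norm_num)
    (fun _ _ => by positivity) (fun _ _ => by positivity)
  simp only [Real.rpow_two, ← Real.sqrt_eq_rpow] at h
  refine le_trans (Real.sqrt_le_sqrt (Finset.sum_le_sum fun m _ => ?_)) h
  refine pow_le_pow_left₀ (by positivity) ?_ 2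
  rw [← add_div]
  exact div_le_div_of_nonneg_right (norm_add_le _ _) (by positivity)

theorem hullNorm_add (γ : ℝ) (a b : ℕ → ℂ) :
    hullNorm γ (a + b) ≤ hullNorm γ a + hullNorm γ b := by
  refine sup_le ?_ (iSup_le fun n => ?_)
  · refine le_trans ?_ (add_le_add le_sup_left le_sup_left)
    rw [← ENNReal.ofReal_add (norm_nonneg _) (norm_nonneg _)]
    exact ENNReal.ofReal_le_ofReal (norm_add_le _ _)
  · refine le_trans ?_ (add_le_add
      (le_trans (le_iSup (fun n : ℕ => ENNReal.ofReal (√(∑ m ∈ Finset.Ico (2 ^ n) (2 ^ (n + 1)),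
        ‖a m‖ ^ 2 / ((m : ℝ) + 1) ^ (2 * γ)))) n) le_sup_right)
      (le_trans (le_iSup (fun n : ℕ => ENNReal.ofReal (√(∑ m ∈ Finset.Ico (2 ^ n) (2 ^ (n + 1)),
        ‖b m‖ ^ 2 / ((m : ℝ) + 1) ^ (2 * γ)))) n) le_sup_right))
    rw [← ENNReal.ofReal_add (Real.sqrt_nonneg _) (Real.sqrt_nonneg _)]
    exact ENNReal.ofReal_le_ofReal (sqrt_block_add γ a b _)

/-- The solid hull `S(H^∞_{v_γ})`, as a space of holomorphic functions on the disc. -/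
structure HullSpace (γ : ℝ) where
  toHol : HolDisc
  mem : coeff toHol ∈ solidHull (weightedSeq γ)

/-- The solid core `s(H^∞_{v_γ})`, as a space of holomorphic functions on the disc. -/
structure CoreSpace (γ : ℝ) where
  toHol : HolDisc
  mem : coeff toHol ∈ solidCore (weightedSeq γ)

/-- `S(H^∞_{v_γ})` carries the metric of its norm. -/
instance (γ : ℝ) : PseudoEMetricSpace (HullSpace γ) where
  edist f g := hullNorm γ (coeff f.toHol - coeff g.toHol)
  edist_self f := by rw [sub_self, hullNorm_zero]
  edist_comm f g := by rw [← hullNorm_neg, neg_sub]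
  edist_triangle f g h := by
    rw [← sub_add_sub_cancel (coeff f.toHol) (coeff g.toHol) (coeff h.toHol)]
    exact hullNorm_add γ _ _

/-- `s(H^∞_{v_γ})` carries the metric of its norm. -/
instance (γ : ℝ) : PseudoEMetricSpace (CoreSpace γ) where
  edist f g := coreNorm γ (coeff f.toHol - coeff g.toHol)
  edist_self f := by rw [sub_self, coreNorm_zero]
  edist_comm f g := by rw [← coreNorm_neg, neg_sub]
  edist_triangle f g h := by
    rw [← sub_add_sub_cancel (coeff f.toHol) (coeff g.toHol) (coeff h.toHol)]
    exact coreNorm_add γ _ _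

/-- `μ` is an `s`-Carleson measure: `μ([t,1)) = O((1-t)^s)` as `t → 1⁻`. -/
def IsCarleson (μ : Measure Interval) (s : ℝ) : Prop :=
  (fun t : ℝ => μ.real {x : Interval | t ≤ (x : ℝ)}) =O[𝓝[<] (1 : ℝ)] fun t => (1 - t) ^ s

/-- The `n`-th moment `μ_n` of `μ`. -/
def moment (μ : Measure Interval) (n : ℕ) : ℝ := ∫ t, (t : ℝ) ^ n ∂μ

/-- `H_μ(f)` is well defined and equal to `g`: with `a_k` the Taylor coefficients of `f`, all the
series `∑_k μ_{n+k} a_k` converge (absolutely), and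
`∑_n (∑_k μ_{n+k} a_k) z^n` converges to `g(z)` for every `z` in the disc. -/
def IsHilbertImage (μ : Measure Interval) (f g : HolDisc) : Prop :=
  (∀ n : ℕ, Summable fun k : ℕ => (moment μ (n + k) : ℂ) * coeff f k) ∧
    ∀ z : Disc, HasSum
      (fun n : ℕ => (∑' k : ℕ, (moment μ (n + k) : ℂ) * coeff f k) * (z : ℂ) ^ n) (g.1 z)

/-- `I_μ(f)` is well defined and equal to `g`: for every `z` in the disc the integral
`∫ f(t) / (1 - t z) dμ(t)` converges (absolutely), with value `g(z)`. -/
def IsIntegralImage (μ : Measure Interval) (f g : HolDisc) : Prop :=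
  ∀ z : Disc, Integrable (fun t : Interval => f.1 t.toDisc / (1 - ((t : ℝ) : ℂ) * z)) μ ∧
    g.1 z = ∫ t : Interval, f.1 t.toDisc / (1 - ((t : ℝ) : ℂ) * z) ∂μ

end HilbertOp

end

noncomputable section

namespace HilbertOp

/-! ### Power series on the disc -/

/-! Both norms control the `ℓ¹`-size of dyadic blocks: `∑ |a_m| ≤ N 2^{jβ}` over the `j`-th block,
with `β = γ` for the core norm and `β = γ + 1/2` for the hull norm, where Cauchy–Schwarz over `2^j`
indices costs `2^{j/2}`. Summing blocks gives `∑ |a_k| t^k ≤ C N (1-t)^{-β}`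
(`exists_sum_norm_mul_pow_le`), and `(1-t)^{-β}` is `μ`-integrable for an `s`-Carleson measure with
`s > β` (`IsCarleson.integrable_rpow`). Fubini then gives `∑_k μ_{n+k} a_k = ∫ t^n f(t) dμ(t)`, and
a second use, with the geometric series in `tz`, gives `H_μ = I_μ` (`exists_hilbert_bound`).

The coefficients of `H_μ(f)` are thus bounded by a multiple of the norm of `f`. On `|z| ≤ R < 1`
this bounds `H_μ(f)` uniformly, hence continuity into `H(𝔻)`. For the self-maps it remains to see
that bounded sequences belong to the target space, with norm at most their supremum. For the hull
with `γ ≥ 1/2`, they are dominated by a multiple of a unimodular sequence with Rudin–Shapiro blocks,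
which lies in `H^∞_{v_γ}`. For the core with `γ ≥ 1`, bounded coefficients give growth at most `M /
(1-|z|)`.

Since the spaces are defined by domination and multipliers, finiteness of the two norms on them must
be proved: by Parseval on circles of radius `1 - 2^{-(j+1)}` for the hull, and by making all
coefficients nonnegative for the core. -/

theorem Disc.norm_lt_one (z : Disc) : ‖(z : ℂ)‖ < 1 := mem_ball_zero_iff.1 z.2

theorem hasFPowerSeriesOnBall_of_hasSum {b : ℕ → ℂ} {F : ℂ → ℂ}
    (hF : ∀ z : ℂ, ‖z‖ < 1 → HasSum (fun n => b n * z ^ n) (F z)) :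
    HasFPowerSeriesOnBall F (FormalMultilinearSeries.ofScalars ℂ b) 0 1 := by
  refine ⟨?_, one_pos, fun {y} hy => ?_⟩
  · refine ENNReal.le_of_forall_nnreal_lt fun r hr => ?_
    have hr1 : (r : ℝ) < 1 := by exact_mod_cast hr
    have hs := (hF ((r : ℝ) : ℂ) (by simpa using hr1)).summable.norm
    refine FormalMultilinearSeries.le_radius_of_summable_norm _ ?_
    simpa [FormalMultilinearSeries.ofScalars_norm] using hs
  · have hy1 : ‖y‖ < 1 := by
      have := Metric.mem_eball.1 hy
      rw [edist_zero_right] at this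
      rwa [← ofReal_norm, ENNReal.ofReal_lt_one] at this
    simpa [FormalMultilinearSeries.ofScalars_apply_eq, zero_add, mul_comm] using hF y hy1

theorem HolDisc.extend_apply (f : HolDisc) {z : ℂ} (hz : ‖z‖ < 1) :
    Function.extend Subtype.val (fun z : Disc => f.1 z) 0 z = f.1 ⟨z, by simpa using hz⟩ :=
  Subtype.val_injective.extend_apply (fun z : Disc => f.1 z) 0 ⟨z, by simpa using hz⟩

theorem hasSum_coeff (f : HolDisc) (z : Disc) :
    HasSum (fun n => coeff f n * (z : ℂ) ^ n) (f.1 z) := by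
  obtain ⟨F, hF, hfF⟩ := f.2
  have hd : DifferentiableOn ℂ (Function.extend Subtype.val (fun z : Disc => f.1 z) 0)
      (Metric.ball 0 1) := by
    refine hF.congr fun w hw => ?_
    rw [HolDisc.extend_apply f (by simpa using hw), hfF]
  have h := Complex.hasSum_taylorSeries_on_ball hd z.2
  rw [HolDisc.extend_apply f z.norm_lt_one] at h
  refine h.congr_fun fun n => ?_
  simp only [coeff, sub_zero, smul_eq_mul, div_eq_mul_inv]
  ring

theorem coeff_eq_of_hasSum {f : HolDisc} {b : ℕ → ℂ}
    (hb : ∀ z : Disc, HasSum (fun n => b n * (z : ℂ) ^ n) (f.1 z)) : coeff f = b := by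
  have h := hasFPowerSeriesOnBall_of_hasSum
    (F := Function.extend Subtype.val (fun z : Disc => f.1 z) 0) (b := b) fun z hz => by
      rw [HolDisc.extend_apply f hz]
      exact hb ⟨z, by simpa using hz⟩
  have h2 := h.analyticAt.hasFPowerSeriesAt.eq_formalMultilinearSeries h.hasFPowerSeriesAt
  exact (FormalMultilinearSeries.ofScalars_series_eq_iff ℂ _ _).1 h2

theorem HolDisc.ext_coeff {f g : HolDisc} (h : coeff f = coeff g) : f = g :=
  Subtype.ext (ContinuousMap.ext fun z => (hasSum_coeff f z).unique (h ▸ hasSum_coeff g z))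

theorem coeff_smul_add_smul (α β : ℂ) (f g : HolDisc) :
    coeff (α • f + β • g) = α • coeff f + β • coeff g :=
  coeff_eq_of_hasSum fun z => by
    convert! ((hasSum_coeff f z).mul_left α).add ((hasSum_coeff g z).mul_left β) using 2 with n
    simp only [Pi.add_apply, Pi.smul_apply, smul_eq_mul]
    ring

theorem summable_norm_coeff (f : HolDisc) {r : ℝ} (hr0 : 0 ≤ r) (hr1 : r < 1) :
    Summable fun n => ‖coeff f n‖ * r ^ n := by
  have h := (hasSum_coeff f ⟨(r : ℂ), by simpa [abs_of_nonneg hr0] using hr1⟩).summable.norm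
  simpa [abs_of_nonneg hr0] using h

/-- The holomorphic function on the disc with a given convergent power series. -/
def HolDisc.ofSeries (b : ℕ → ℂ) (hb : ∀ z : ℂ, ‖z‖ < 1 → Summable fun n => b n * z ^ n) :
    HolDisc :=
  have hd : DifferentiableOn ℂ (fun z : ℂ => ∑' n, b n * z ^ n) (Metric.ball 0 1) := by
    have := (hasFPowerSeriesOnBall_of_hasSum (b := b) (F := fun z : ℂ => ∑' n, b n * z ^ n)
      fun z hz => (hb z hz).hasSum).differentiableOn
    refine this.mono fun w hw => ?_
    rw [← ENNReal.ofReal_one, Metric.eball_ofReal]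
    exact hw
  ⟨⟨fun z => ∑' n, b n * (z : ℂ) ^ n, hd.continuousOn.domRestrict⟩, _, hd, fun _ => rfl⟩

theorem HolDisc.hasSum_ofSeries (b : ℕ → ℂ)
    (hb : ∀ z : ℂ, ‖z‖ < 1 → Summable fun n => b n * z ^ n) (z : Disc) :
    HasSum (fun n => b n * (z : ℂ) ^ n) ((HolDisc.ofSeries b hb).1 z) :=
  (hb z z.norm_lt_one).hasSum

theorem coeff_ofSeries (b : ℕ → ℂ) (hb : ∀ z : ℂ, ‖z‖ < 1 → Summable fun n => b n * z ^ n) :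
    coeff (HolDisc.ofSeries b hb) = b :=
  coeff_eq_of_hasSum (HolDisc.hasSum_ofSeries b hb)

theorem summable_mul_pow_of_bounded {b : ℕ → ℂ} {C : ℝ} (hb : ∀ n, ‖b n‖ ≤ C) (z : ℂ)
    (hz : ‖z‖ < 1) : Summable fun n => b n * z ^ n := by
  refine Summable.of_norm_bounded
    ((summable_geometric_of_lt_one (norm_nonneg z) hz).mul_left C) fun n => ?_
  rw [norm_mul, norm_pow]
  exact mul_le_mul_of_nonneg_right (hb n) (by positivity)

/-- Serves both for uniform estimates on compact sets and for membership in `H^∞_{v_γ}` when `γ ≥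
1`. -/
theorem norm_le_of_coeff_bounded {f : HolDisc} {C : ℝ} (hb : ∀ n, ‖coeff f n‖ ≤ C) (z : Disc) :
    ‖f.1 z‖ ≤ C / (1 - ‖(z : ℂ)‖) := by
  have hg := (hasSum_geometric_of_lt_one (norm_nonneg (z : ℂ)) z.norm_lt_one).mul_left C
  rw [← div_eq_mul_inv] at hg
  refine (hasSum_coeff f z).norm_le_of_bounded hg fun n => ?_
  rw [norm_mul, norm_pow]
  exact mul_le_mul_of_nonneg_right (hb n) (by positivity)

/-- Parseval's inequality on a circle. -/
theorem sum_sq_norm_coeff_le (f : HolDisc) {r M : ℝ} (hr0 : 0 ≤ r) (hr1 : r < 1)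
    (hM : ∀ z : Disc, ‖(z : ℂ)‖ = r → ‖f.1 z‖ ≤ M) (s : Finset ℕ) :
    ∑ m ∈ s, (‖coeff f m‖ * r ^ m) ^ 2 ≤ M ^ 2 := by
  have : Fact (0 < (1 : ℝ)) := ⟨one_pos⟩
  have hM0 : 0 ≤ M := (norm_nonneg _).trans
    (hM ⟨(r : ℂ), by simpa [abs_of_nonneg hr0] using hr1⟩ (by simp [abs_of_nonneg hr0]))
  -- The restriction of `f` to the circle of radius `r` is a uniformly convergent Fourier series
  -- with coefficients `coeff f n * r ^ n`; Bessel's inequality then gives the claim.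
  set u : ℕ → C(AddCircle (1 : ℝ), ℂ) := fun n => (coeff f n * (r : ℂ) ^ n) • fourier (n : ℤ)
    with hu
  have hsum : Summable u := by
    refine Summable.of_norm ?_
    refine (summable_norm_coeff f hr0 hr1).congr fun n => ?_
    simp [hu, norm_smul, fourier_norm, abs_of_nonneg hr0]
  set G := ∑' n, u n with hG
  have hGn : ‖G‖ ≤ M := by
    refine (ContinuousMap.norm_le _ hM0).2 fun x => ?_
    have h1 : HasSum (fun n => u n x) (G x) :=
      (ContinuousMap.evalCLM ℂ x).hasSum hsum.hasSum
    have hz : ‖(r : ℂ) * fourier 1 x‖ = r := by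
      rw [norm_mul, fourier_apply, Circle.norm_coe]
      simp [abs_of_nonneg hr0]
    have h2 := hasSum_coeff f ⟨(r : ℂ) * fourier 1 x, by
      rw [mem_ball_zero_iff, hz]; exact hr1⟩
    have h3 : G x = _ := h1.unique (h2.congr_fun fun n => by
      simp only [hu, mul_pow, mul_assoc, fourier_apply, AddCircle.toCircle_zsmul,
        ContinuousMap.smul_apply, smul_eq_mul, zpow_natCast, one_smul, Circle.coe_pow])
    rw [h3]
    exact hM _ hz
  have hL : ‖ContinuousMap.toLp (E := ℂ) 2 AddCircle.haarAddCircle ℂ G‖ ≤ M := by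
    refine (ContinuousLinearMap.le_opNorm _ _).trans ?_
    refine (mul_le_mul (ContinuousMap.toLp_norm_le _) hGn (norm_nonneg _) (by positivity)).trans ?_
    simp [measureUnivNNReal]
  have hin : ∀ m : ℕ, inner ℂ (fourierLp 2 (m : ℤ))
      (ContinuousMap.toLp (E := ℂ) 2 (AddCircle.haarAddCircle (T := 1)) ℂ G) =
        coeff f m * (r : ℂ) ^ m := by
    intro m
    have h1 : HasSum (fun n => inner ℂ (fourierLp 2 (m : ℤ))
        (ContinuousMap.toLp (E := ℂ) 2 (AddCircle.haarAddCircle (T := 1)) ℂ (u n))) _ :=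
      ((innerSL ℂ (fourierLp 2 (m : ℤ))).comp
        (ContinuousMap.toLp (E := ℂ) 2 (AddCircle.haarAddCircle (T := 1)) ℂ)).hasSum hsum.hasSum
    refine h1.unique ?_
    have h2 := hasSum_ite_eq m (coeff f m * (r : ℂ) ^ m)
    refine h2.congr_fun fun n => ?_
    simp only [hu, map_smul, inner_smul_right]
    have := (orthonormal_iff_ite.1 (orthonormal_fourier (T := 1))) (m : ℤ) (n : ℤ)
    rw [this]
    by_cases h : n = m
    · subst h; simp
    · have : m ≠ n := fun h' => h h'.symm
      simp [h, this]
  have hB := (orthonormal_fourier (T := 1)).comp (fun n : ℕ => (n : ℤ)) Nat.cast_injective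
    |>.sum_inner_products_le
      (ContinuousMap.toLp (E := ℂ) 2 (AddCircle.haarAddCircle (T := 1)) ℂ G) (s := s)
  refine le_trans (le_of_eq ?_) (hB.trans (pow_le_pow_left₀ (norm_nonneg _) hL 2))
  refine Finset.sum_congr rfl fun m _ => ?_
  rw [Function.comp_apply, hin]
  simp [abs_of_nonneg hr0]

/-! ### Dyadic sums -/

theorem sum_range_two_pow {M : Type*} [AddCommMonoid M] (u : ℕ → M) (J : ℕ) :
    ∑ m ∈ Finset.range (2 ^ J), u m =
      u 0 + ∑ j ∈ Finset.range J, ∑ m ∈ Finset.Ico (2 ^ j) (2 ^ (j + 1)), u m := by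
  induction J with
  | zero => simp
  | succ J ih =>
    rw [Finset.sum_range_succ, ← add_assoc, ← ih,
      Finset.sum_range_add_sum_Ico _ (Nat.pow_le_pow_right two_pos J.le_succ)]

/-- Raise `y / a ≤ exp (y / a)` to the power `a`. -/
theorem rpow_mul_exp_neg_le {a y : ℝ} (ha : 0 < a) (hy : 0 ≤ y) :
    y ^ a * Real.exp (-y) ≤ a ^ a := by
  have h1 : y / a ≤ Real.exp (y / a) := by linarith [Real.add_one_le_exp (y / a)]
  have h2 : (y / a) ^ a ≤ Real.exp y := by
    refine (Real.rpow_le_rpow (by positivity) h1 ha.le).trans_eq ?_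
    rw [← Real.exp_mul, div_mul_cancel₀ _ ha.ne']
  rw [Real.div_rpow hy ha.le, div_le_iff₀ (by positivity)] at h2
  rw [Real.exp_neg, ← div_eq_mul_inv, div_le_iff₀ (Real.exp_pos _), mul_comm]
  exact h2

theorem geom_sum_le {q : ℝ} (hq0 : 0 ≤ q) (hq1 : q < 1) (n : ℕ) :
    ∑ i ∈ Finset.range n, q ^ i ≤ (1 - q)⁻¹ :=
  (summable_geometric_of_lt_one hq0 hq1).sum_le_tsum _ (fun _ _ => by positivity)
    |>.trans_eq (tsum_geometric_of_lt_one hq0 hq1)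

/-- Split at the `K` with `2^K ≤ 1/(1-r) < 2^(K+1)`. Up to `K` the powers grow geometrically, so the
last one dominates; beyond `K` the decay of `r^(2^j)` wins. -/
theorem exists_dyadic_sum_le {β : ℝ} (hβ : 0 < β) :
    ∃ C : ℝ, 0 ≤ C ∧ ∀ r : ℝ, 0 ≤ r → r < 1 → ∀ J : ℕ,
      ∑ j ∈ Finset.range J, ((2 : ℝ) ^ j) ^ β * r ^ (2 ^ j) ≤ C * (1 - r) ^ (-β) := by
  set q : ℝ := (2 : ℝ) ^ (-β) with hq
  have hq0 : 0 < q := by positivity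
  have hq1 : q < 1 := Real.rpow_lt_one_of_one_lt_of_neg one_lt_two (by linarith)
  have hqpow : ∀ i : ℕ, q ^ i = ((2 : ℝ) ^ i) ^ (-β) := fun i => by
    rw [hq, ← Real.rpow_natCast, ← Real.rpow_natCast, ← Real.rpow_mul two_pos.le,
      ← Real.rpow_mul two_pos.le, mul_comm]
  -- The exponent `2β`, not `β`, is bounded against `exp (-y)`: this leaves a factor `y^(-β)`, which
  -- makes the tail geometric.
  set D : ℝ := (2 * β) ^ (2 * β) with hD
  have hD0 : 0 < D := by positivity
  refine ⟨(1 + D) * (1 - q)⁻¹, by have := sub_pos.2 hq1; positivity, fun r hr0 hr1 J => ?_⟩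
  set x := 1 - r with hx
  have hx0 : 0 < x := by linarith
  have hx1 : x ≤ 1 := by linarith
  obtain ⟨K, hK1, hK2⟩ := exists_nat_pow_near (one_le_inv_iff₀.2 ⟨hx0, hx1⟩) one_lt_two
  have hxβ : 0 < x ^ (-β) := by positivity
  have hlow : ∀ j ∈ Finset.range (K + 1),
      ((2 : ℝ) ^ j) ^ β * r ^ (2 ^ j) ≤ x ^ (-β) * q ^ (K - j) := by
    intro j hj
    have hjK : j ≤ K := Nat.lt_succ_iff.1 (Finset.mem_range.1 hj)
    have h1 : ((2 : ℝ) ^ j) ^ β = ((2 : ℝ) ^ K) ^ β * q ^ (K - j) := by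
      rw [hqpow, Real.rpow_neg (by positivity), ← div_eq_mul_inv, eq_div_iff (by positivity),
        ← Real.mul_rpow (by positivity) (by positivity), ← pow_add, Nat.add_sub_cancel' hjK]
    have h2 : ((2 : ℝ) ^ K) ^ β ≤ x ^ (-β) := by
      rw [Real.rpow_neg hx0.le, ← Real.inv_rpow hx0.le]
      exact Real.rpow_le_rpow (by positivity) hK1 hβ.le
    calc ((2 : ℝ) ^ j) ^ β * r ^ (2 ^ j) ≤ ((2 : ℝ) ^ j) ^ β * 1 :=
          mul_le_mul_of_nonneg_left (pow_le_one₀ hr0 hr1.le) (by positivity)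
      _ = ((2 : ℝ) ^ K) ^ β * q ^ (K - j) := by rw [mul_one, h1]
      _ ≤ _ := mul_le_mul_of_nonneg_right h2 (by positivity)
  have hhigh : ∀ i ∈ Finset.range J,
      ((2 : ℝ) ^ (K + 1 + i)) ^ β * r ^ (2 ^ (K + 1 + i)) ≤ x ^ (-β) * (D * q ^ i) := by
    intro i _
    set y : ℝ := 2 ^ (K + 1 + i) * x with hy
    have hy0 : 0 < y := by positivity
    have hyi : (2 : ℝ) ^ i ≤ y := by
      rw [hy, pow_add]
      have : 1 ≤ (2 : ℝ) ^ (K + 1) * x := by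
        rw [inv_lt_iff_one_lt_mul₀ hx0] at hK2
        linarith
      nlinarith [pow_pos (two_pos (α := ℝ)) i]
    have h1 : r ^ (2 ^ (K + 1 + i)) ≤ Real.exp (-y) := by
      have : r ≤ Real.exp (-x) := by linarith [Real.add_one_le_exp (-x)]
      refine (pow_le_pow_left₀ hr0 this _).trans_eq ?_
      rw [← Real.exp_nat_mul, hy]
      push_cast
      ring_nf
    have h2 : ((2 : ℝ) ^ (K + 1 + i)) ^ β = x ^ (-β) * y ^ β := by
      rw [hy, Real.mul_rpow (by positivity) hx0.le, Real.rpow_neg hx0.le]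
      have : x ^ β ≠ 0 := by positivity
      field_simp
    have h3 : y ^ β * Real.exp (-y) ≤ D * y ^ (-β) := by
      have := rpow_mul_exp_neg_le (a := 2 * β) (by positivity) hy0.le
      rw [two_mul β, Real.rpow_add hy0, ← two_mul β] at this
      rw [Real.rpow_neg hy0.le, ← div_eq_mul_inv, le_div_iff₀ (by positivity)]
      linarith
    have h4 : y ^ (-β) ≤ q ^ i := by
      rw [hqpow]
      exact Real.rpow_le_rpow_of_nonpos (by positivity) hyi (by linarith)
    calc _ ≤ (x ^ (-β) * y ^ β) * Real.exp (-y) := by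
          rw [h2]; exact mul_le_mul_of_nonneg_left h1 (by positivity)
      _ = x ^ (-β) * (y ^ β * Real.exp (-y)) := by ring
      _ ≤ _ := mul_le_mul_of_nonneg_left
          (h3.trans (mul_le_mul_of_nonneg_left h4 hD0.le)) hxβ.le
  calc ∑ j ∈ Finset.range J, ((2 : ℝ) ^ j) ^ β * r ^ (2 ^ j)
      ≤ ∑ j ∈ Finset.range (K + 1 + J), ((2 : ℝ) ^ j) ^ β * r ^ (2 ^ j) :=
        Finset.sum_le_sum_of_subset_of_nonneg (Finset.range_mono (by omega))
          fun _ _ _ => by positivity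
    _ ≤ ∑ j ∈ Finset.range (K + 1), x ^ (-β) * q ^ (K - j) +
          ∑ i ∈ Finset.range J, x ^ (-β) * (D * q ^ i) := by
        rw [Finset.sum_range_add]
        exact add_le_add (Finset.sum_le_sum hlow) (Finset.sum_le_sum hhigh)
    _ = x ^ (-β) * (∑ i ∈ Finset.range (K + 1), q ^ i + D * ∑ i ∈ Finset.range J, q ^ i) := by
        rw [← Finset.mul_sum, ← Finset.mul_sum, ← Finset.mul_sum, mul_add,
          ← Finset.sum_range_reflect (fun i => q ^ i) (K + 1)]
        simp
    _ ≤ x ^ (-β) * ((1 - q)⁻¹ + D * (1 - q)⁻¹) := by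
        gcongr <;> exact geom_sum_le hq0.le hq1 _
    _ = _ := by ring

/-- The blocks `{0}` and `{2^j, …, 2^(j+1) - 1}` of the sequence `a` have `ℓ¹`-norms at most
`N` and `N 2^(jβ)`. -/
def BlockBounded (β N : ℝ) (a : ℕ → ℂ) : Prop :=
  ‖a 0‖ ≤ N ∧ ∀ j : ℕ, ∑ m ∈ Finset.Ico (2 ^ j) (2 ^ (j + 1)), ‖a m‖ ≤ N * ((2 : ℝ) ^ j) ^ β

theorem exists_sum_norm_mul_pow_le {β : ℝ} (hβ : 0 < β) :
    ∃ C : ℝ, 0 ≤ C ∧ ∀ (a : ℕ → ℂ) (N r : ℝ), BlockBounded β N a → 0 ≤ r → r < 1 →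
      ∀ s : Finset ℕ, ∑ k ∈ s, ‖a k‖ * r ^ k ≤ C * N * (1 - r) ^ (-β) := by
  obtain ⟨C, hC0, hC⟩ := exists_dyadic_sum_le hβ
  refine ⟨1 + C, by positivity, fun a N r ha hr0 hr1 s => ?_⟩
  have hN : 0 ≤ N := (norm_nonneg _).trans ha.1
  obtain ⟨J, hJ⟩ : ∃ J, s ⊆ Finset.range (2 ^ J) := by
    refine ⟨s.sup id, fun k hk => Finset.mem_range.2 ?_⟩
    exact (Finset.le_sup (f := id) hk).trans_lt Nat.lt_two_pow_self
  -- The block `{0}` is absorbed here; it accounts for the `1` in `1 + C`.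
  have hr : 1 ≤ (1 - r) ^ (-β) :=
    Real.one_le_rpow_of_pos_of_le_one_of_nonpos (by linarith) (by linarith) (by linarith)
  calc ∑ k ∈ s, ‖a k‖ * r ^ k ≤ ∑ k ∈ Finset.range (2 ^ J), ‖a k‖ * r ^ k :=
        Finset.sum_le_sum_of_subset_of_nonneg hJ fun _ _ _ => by positivity
    _ = ‖a 0‖ + ∑ j ∈ Finset.range J,
          ∑ m ∈ Finset.Ico (2 ^ j) (2 ^ (j + 1)), ‖a m‖ * r ^ m := by
        rw [sum_range_two_pow]; simp
    _ ≤ N + ∑ j ∈ Finset.range J, N * (((2 : ℝ) ^ j) ^ β * r ^ (2 ^ j)) := by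
        refine add_le_add ha.1 (Finset.sum_le_sum fun j _ => ?_)
        rw [← mul_assoc]
        refine le_trans ?_ (mul_le_mul_of_nonneg_right (ha.2 j) (by positivity))
        rw [Finset.sum_mul]
        refine Finset.sum_le_sum fun m hm => mul_le_mul_of_nonneg_left ?_ (norm_nonneg _)
        exact pow_le_pow_of_le_one hr0 hr1.le (Finset.mem_Ico.1 hm).1
    _ ≤ N * (1 - r) ^ (-β) + N * (C * (1 - r) ^ (-β)) := by
        rw [← Finset.mul_sum]
        exact add_le_add (le_mul_of_one_le_right hN hr)
          (mul_le_mul_of_nonneg_left (hC r hr0 hr1 J) hN)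
    _ = _ := by ring

/-! ### Carleson measures -/

/-- Layer decomposition: where `2^j ≤ 1/(1-t) < 2^(j+1)` the integrand is at most `2^((j+1)β)`, and
this set lies in `E j`, of measure `O(2^(-js))`. The resulting series is geometric with ratio
`2^(β-s) < 1`. -/
theorem IsCarleson.integrable_rpow {μ : Measure Interval} [IsFiniteMeasure μ] {s β : ℝ}
    (hμ : IsCarleson μ s) (hβ : 0 < β) (hβs : β < s) :
    Integrable (fun t : Interval => (1 - (t : ℝ)) ^ (-β)) μ := by
  set E : ℕ → Set Interval := fun j => {t | 1 - ((2 : ℝ) ^ j)⁻¹ ≤ (t : ℝ)} with hE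
  have hEm : ∀ j, MeasurableSet (E j) := fun j =>
    measurableSet_le measurable_const measurable_subtype_coe
  have htend : Tendsto (fun j : ℕ => 1 - ((2 : ℝ) ^ j)⁻¹) atTop (𝓝[<] 1) := by
    refine tendsto_nhdsWithin_iff.2 ⟨?_, Eventually.of_forall fun j => ?_⟩
    · have h := tendsto_inv_atTop_zero.comp (tendsto_pow_atTop_atTop_of_one_lt (one_lt_two (α := ℝ)))
      simpa using h.const_sub 1
    · simp
  have hO : (fun j : ℕ => μ.real (E j)) =O[atTop] fun j : ℕ => (((2 : ℝ) ^ j)⁻¹) ^ s := by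
    exact (hμ.comp_tendsto htend).congr_right fun j => by simp
  have hsum : Summable fun j : ℕ => ((2 : ℝ) ^ (j + 1)) ^ β * μ.real (E j) := by
    have hq1 : (2 : ℝ) ^ (β - s) < 1 :=
      Real.rpow_lt_one_of_one_lt_of_neg one_lt_two (by linarith)
    refine summable_of_isBigO_nat
      (((summable_geometric_of_lt_one (by positivity) hq1)).mul_left ((2 : ℝ) ^ β)) ?_
    refine ((Asymptotics.isBigO_refl (fun j : ℕ => ((2 : ℝ) ^ (j + 1)) ^ β) atTop).mul
      hO).congr_right fun j => ?_
    rw [pow_succ, Real.mul_rpow (by positivity) (by positivity), Real.inv_rpow (by positivity),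
      ← Real.rpow_natCast, ← Real.rpow_mul (by positivity), ← Real.rpow_mul (by positivity),
      ← Real.rpow_neg (by positivity), ← Real.rpow_natCast, ← Real.rpow_mul (by positivity),
      mul_right_comm, ← Real.rpow_add two_pos, mul_comm, ← Real.rpow_add two_pos,
      ← Real.rpow_add two_pos]
    ring_nf
  have hmeas : AEStronglyMeasurable (fun t : Interval => (1 - (t : ℝ)) ^ (-β)) μ :=
    ((measurable_const.sub measurable_subtype_coe).pow_const _).aestronglyMeasurable
  refine ⟨hmeas, ?_⟩
  have hpt : ∀ t : Interval, ‖(1 - (t : ℝ)) ^ (-β)‖ₑ ≤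
      ∑' j : ℕ, (E j).indicator (fun _ => ENNReal.ofReal (((2 : ℝ) ^ (j + 1)) ^ β)) t := by
    intro t
    have hx0 : 0 < 1 - (t : ℝ) := by linarith [t.2.2]
    have hx1 : 1 - (t : ℝ) ≤ 1 := by linarith [t.2.1]
    obtain ⟨j, hj1, hj2⟩ := exists_nat_pow_near (one_le_inv_iff₀.2 ⟨hx0, hx1⟩) (one_lt_two (α := ℝ))
    refine le_trans ?_ (ENNReal.le_tsum j)
    rw [Set.indicator_of_mem, Real.enorm_of_nonneg (by positivity)]
    · refine ENNReal.ofReal_le_ofReal ?_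
      rw [Real.rpow_neg hx0.le, ← Real.inv_rpow hx0.le]
      exact Real.rpow_le_rpow (by positivity) hj2.le hβ.le
    · have := (le_inv_comm₀ (by positivity) hx0).1 hj1
      simp only [hE, Set.mem_ofPred_eq]
      linarith
  refine (lintegral_mono hpt).trans_lt ?_
  rw [lintegral_tsum fun j => (measurable_const.indicator (hEm j)).aemeasurable]
  have : ∀ j, ∫⁻ t, (E j).indicator (fun _ => ENNReal.ofReal (((2 : ℝ) ^ (j + 1)) ^ β)) t ∂μ =
      ENNReal.ofReal (((2 : ℝ) ^ (j + 1)) ^ β * μ.real (E j)) := fun j => by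
    rw [lintegral_indicator_const (hEm j), ENNReal.ofReal_mul (by positivity),
      ofReal_measureReal]
  simp_rw [this]
  exact hsum.tsum_ofReal_lt_top

/-! ### The Hilbert operator -/

/-- The `n`-th coefficient of `H_μ(f)`. -/
def hilbertCoeff (μ : Measure Interval) (f : HolDisc) (n : ℕ) : ℂ :=
  ∑' k : ℕ, (moment μ (n + k) : ℂ) * coeff f k

open Classical in
/-- The holomorphic function with Taylor coefficients `hilbertCoeff μ f`, provided that these are
bounded. -/
def hilbertOp (μ : Measure Interval) (f : HolDisc) : HolDisc :=
  if h : ∃ C : ℝ, ∀ n, ‖hilbertCoeff μ f n‖ ≤ C then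
    HolDisc.ofSeries (hilbertCoeff μ f) (summable_mul_pow_of_bounded h.choose_spec)
  else 0

theorem coeff_hilbertOp {μ : Measure Interval} {f : HolDisc} {C : ℝ}
    (h : ∀ n, ‖hilbertCoeff μ f n‖ ≤ C) : coeff (hilbertOp μ f) = hilbertCoeff μ f := by
  rw [hilbertOp, dif_pos ⟨C, h⟩, coeff_ofSeries]

theorem integrable_pow (μ : Measure Interval) [IsFiniteMeasure μ] (n : ℕ) :
    Integrable (fun t : Interval => (t : ℝ) ^ n) μ := by
  refine (integrable_const (1 : ℝ)).mono'
    (measurable_subtype_coe.pow_const n).aestronglyMeasurable (Eventually.of_forall fun t => ?_)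
  rw [norm_pow, Real.norm_of_nonneg t.2.1]
  exact pow_le_one₀ t.2.1 t.2.2.le

theorem hasSum_coeff_toDisc (f : HolDisc) (t : Interval) :
    HasSum (fun k => coeff f k * ((t : ℝ) : ℂ) ^ k) (f.1 t.toDisc) :=
  hasSum_coeff f t.toDisc

theorem measurable_comp_toDisc (f : HolDisc) : Measurable fun t : Interval => f.1 t.toDisc := by
  refine (f.1.continuous.comp (?_ : Continuous Interval.toDisc)).measurable
  exact Continuous.subtype_mk (Complex.continuous_ofReal.comp continuous_subtype_val) _

/-- On the disc, `H_μ(f)` and `I_μ(f)` are well defined and equal, with a bound for the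
coefficients, as soon as the coefficients of `f` satisfy a block condition with exponent `β < s`. -/
theorem exists_hilbert_bound {μ : Measure Interval} [IsFiniteMeasure μ] {s β : ℝ}
    (hμ : IsCarleson μ s) (hβ : 0 < β) (hβs : β < s) :
    ∃ A : ℝ, 0 ≤ A ∧ ∀ (f : HolDisc) (N : ℝ), BlockBounded β N (coeff f) →
      (∀ n, Summable fun k : ℕ => (moment μ (n + k) : ℂ) * coeff f k) ∧
      (∀ n, ‖hilbertCoeff μ f n‖ ≤ A * N) ∧
      ∀ z : Disc, Integrable (fun t : Interval => f.1 t.toDisc / (1 - ((t : ℝ) : ℂ) * z)) μ ∧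
        HasSum (fun n => hilbertCoeff μ f n * (z : ℂ) ^ n)
          (∫ t : Interval, f.1 t.toDisc / (1 - ((t : ℝ) : ℂ) * z) ∂μ) := by
  obtain ⟨C, hC0, hC⟩ := exists_sum_norm_mul_pow_le hβ
  have hw := hμ.integrable_rpow hβ hβs
  set w : Interval → ℝ := fun t => (1 - (t : ℝ)) ^ (-β) with hwdef
  have hw0 : ∀ t, 0 ≤ w t := fun t => Real.rpow_nonneg (by linarith [t.2.2]) _
  refine ⟨C * ∫ t, w t ∂μ, mul_nonneg hC0 (integral_nonneg hw0), fun f N hf => ?_⟩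
  have hN : 0 ≤ N := (norm_nonneg _).trans hf.1
  have hfw : ∀ t : Interval, ‖f.1 t.toDisc‖ ≤ C * N * w t := fun t => by
    have hs := summable_norm_coeff f t.2.1 t.2.2
    refine ((hasSum_coeff_toDisc f t).norm_le_of_bounded hs.hasSum fun k => ?_).trans
      (hs.tsum_le_of_sum_le fun s => hC _ _ _ hf t.2.1 t.2.2 s)
    simp [abs_of_nonneg t.2.1]
  have hfm := measurable_comp_toDisc f
  have htm : Measurable fun t : Interval => ((t : ℝ) : ℂ) :=
    Complex.measurable_ofReal.comp measurable_subtype_coe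
  have hpow : ∀ (t : Interval) (n : ℕ), ‖((t : ℝ) : ℂ) ^ n‖ ≤ 1 := fun t n => by
    rw [norm_pow, Complex.norm_real, Real.norm_of_nonneg t.2.1]
    exact pow_le_one₀ t.2.1 t.2.2.le
  have hint : ∀ n : ℕ, Integrable (fun t : Interval => ((t : ℝ) : ℂ) ^ n * f.1 t.toDisc) μ :=
    fun n => (hw.const_mul (C * N)).mono' ((htm.pow_const n).mul hfm).aestronglyMeasurable
      (Eventually.of_forall fun t => by
        rw [norm_mul]
        exact (mul_le_of_le_one_left (norm_nonneg _) (hpow t n)).trans (hfw t))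
  have hintn : ∀ n : ℕ, ∫ t : Interval, ‖((t : ℝ) : ℂ) ^ n * f.1 t.toDisc‖ ∂μ ≤
      C * (∫ t, w t ∂μ) * N := fun n => by
    rw [mul_right_comm, ← integral_const_mul]
    refine integral_mono (hint n).norm (hw.const_mul _) fun t => ?_
    rw [norm_mul]
    exact (mul_le_of_le_one_left (norm_nonneg _) (hpow t n)).trans (hfw t)
  have hterm : ∀ n k : ℕ, ∫ t : Interval, ((t : ℝ) : ℂ) ^ (n + k) * coeff f k ∂μ =
      (moment μ (n + k) : ℂ) * coeff f k := fun n k => by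
    rw [integral_mul_const, moment, ← integral_complex_ofReal]
    simp
  have hterm_int : ∀ n k : ℕ,
      Integrable (fun t : Interval => ((t : ℝ) : ℂ) ^ (n + k) * coeff f k) μ := fun n k => by
    refine Integrable.mul_const ?_ _
    have := (integrable_pow μ (n + k)).ofReal (𝕜 := ℂ)
    simpa using this
  -- Every finite sum of the integrands is at most `C * N * w t` pointwise, so the integrals of the
  -- norms are summable, which is what the exchange of sum and integral needs.
  have hnsum : ∀ n : ℕ, Summable fun k : ℕ =>
      ∫ t : Interval, ‖((t : ℝ) : ℂ) ^ (n + k) * coeff f k‖ ∂μ := fun n => by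
    refine summable_of_sum_le (c := ∫ t, C * N * w t ∂μ)
      (fun k => integral_nonneg fun t => norm_nonneg _) fun S => ?_
    rw [← integral_finsetSum _ fun k _ => (hterm_int n k).norm]
    refine integral_mono (integrable_finsetSum _ fun k _ => (hterm_int n k).norm)
      (hw.const_mul _) fun t => ?_
    refine (Finset.sum_le_sum fun k _ => ?_).trans (hC _ _ _ hf t.2.1 t.2.2 S)
    rw [pow_add, mul_assoc, norm_mul]
    refine (mul_le_of_le_one_left (norm_nonneg _) (hpow t n)).trans_eq ?_
    rw [norm_mul, norm_pow, Complex.norm_real, Real.norm_of_nonneg t.2.1, mul_comm]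
  have hb : ∀ n : ℕ, HasSum (fun k : ℕ => (moment μ (n + k) : ℂ) * coeff f k)
      (∫ t : Interval, ((t : ℝ) : ℂ) ^ n * f.1 t.toDisc ∂μ) := fun n => by
    have h := hasSum_integral_of_summable_integral_norm (hterm_int n) (hnsum n)
    simp only [hterm] at h
    convert! h using 1
    refine integral_congr_ae (Eventually.of_forall fun t => ?_)
    refine (((hasSum_coeff_toDisc f t).mul_left (((t : ℝ) : ℂ) ^ n)).congr_fun
      fun k => ?_).tsum_eq.symm
    ring
  have hcoef : ∀ n, hilbertCoeff μ f n = ∫ t : Interval, ((t : ℝ) : ℂ) ^ n * f.1 t.toDisc ∂μ :=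
    fun n => (hb n).tsum_eq
  refine ⟨fun n => (hb n).summable, fun n => ?_, fun z => ⟨?_, ?_⟩⟩
  · rw [hcoef]
    exact (norm_integral_le_integral_norm _).trans (hintn n)
  · have hz : 0 < 1 - ‖(z : ℂ)‖ := by linarith [z.norm_lt_one]
    refine ((hw.const_mul (C * N)).div_const (1 - ‖(z : ℂ)‖)).mono'
      (hfm.div (measurable_const.sub (htm.mul_const _))).aestronglyMeasurable
      (Eventually.of_forall fun t => ?_)
    rw [norm_div]
    refine div_le_div₀ (mul_nonneg (mul_nonneg hC0 hN) (hw0 t)) (hfw t) hz ?_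
    have h1 : ‖((t : ℝ) : ℂ) * (z : ℂ)‖ ≤ ‖(z : ℂ)‖ := by
      rw [norm_mul]
      exact mul_le_of_le_one_left (norm_nonneg _) (by simpa using hpow t 1)
    have h2 := norm_sub_norm_le (1 : ℂ) (((t : ℝ) : ℂ) * (z : ℂ))
    rw [norm_one] at h2
    linarith
  -- Second exchange, now in `n`: the integrals of the norms are at most a constant times `‖z‖ ^ n`,
  -- and summing under the integral restores `1 / (1 - t z)`.
  · have h := hasSum_integral_of_summable_integral_norm (μ := μ)
      (F := fun (n : ℕ) (t : Interval) => ((t : ℝ) : ℂ) ^ n * f.1 t.toDisc * (z : ℂ) ^ n)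
      (fun n => (hint n).mul_const _) (by
        refine Summable.of_nonneg_of_le (fun n => integral_nonneg fun t => norm_nonneg _)
          (fun n => ?_) ((summable_geometric_of_lt_one (norm_nonneg (z : ℂ))
            z.norm_lt_one).mul_left (C * (∫ t, w t ∂μ) * N))
        simp only [norm_mul _ ((z : ℂ) ^ n), norm_pow (z : ℂ)]
        rw [integral_mul_const]
        exact mul_le_mul_of_nonneg_right (hintn n) (by positivity))
    simp only [integral_mul_const, ← hcoef] at h
    convert! h using 1
    refine integral_congr_ae (Eventually.of_forall fun t => ?_)
    have hz : ‖((t : ℝ) : ℂ) * (z : ℂ)‖ < 1 := by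
      rw [norm_mul]
      exact (mul_le_of_le_one_left (norm_nonneg _) (by simpa using hpow t 1)).trans_lt
        z.norm_lt_one
    refine (((hasSum_geometric_of_norm_lt_one hz).mul_left (f.1 t.toDisc)).congr_fun
      fun n => ?_).tsum_eq.symm
    rw [mul_pow]
    ring

theorem HolDisc.sub_eq_smul_add_smul (f g : HolDisc) : f - g = (1 : ℂ) • f + (-1 : ℂ) • g :=
  Subtype.ext (ContinuousMap.ext fun z => by simp [sub_eq_add_neg])

theorem coeff_sub (f g : HolDisc) : coeff (f - g) = coeff f - coeff g := by
  rw [HolDisc.sub_eq_smul_add_smul, coeff_smul_add_smul]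
  simp [sub_eq_add_neg]

/-- A compact subset of the disc lies in some `|z| ≤ R < 1`, where the coefficient bound gives a
uniform bound with the factor `1 / (1 - R)`. Only points at finite distance matter, since the unit
ball about `f` is a neighbourhood. -/
theorem continuous_holDisc_of_coeff {X : Type*} [PseudoEMetricSpace X] {T : X → HolDisc} {A : ℝ}
    (hT : ∀ f g : X, edist f g ≠ ⊤ → ∀ n,
      ‖coeff (T f) n - coeff (T g) n‖ ≤ A * (edist f g).toReal) : Continuous T := by
  refine continuous_induced_rng.2 (continuous_iff_continuousAt.2 fun f => ?_)
  refine ContinuousMap.tendsto_iff_forall_isCompact_tendstoUniformlyOn.2 fun K hK => ?_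
  obtain ⟨R, hR1, hR⟩ : ∃ R : ℝ, R < 1 ∧ ∀ z ∈ K, ‖(z : ℂ)‖ ≤ R := by
    rcases K.eq_empty_or_nonempty with rfl | hne
    · exact ⟨0, one_pos, by simp⟩
    · obtain ⟨z, -, hz⟩ := hK.exists_isMaxOn hne (continuous_subtype_val.norm).continuousOn
      exact ⟨‖(z : ℂ)‖, z.norm_lt_one, fun w hw => hz hw⟩
  have hlim : Tendsto (fun g => A * (edist f g).toReal / (1 - R)) (𝓝 f) (𝓝 0) := by
    have h1 : Tendsto (fun g => edist f g) (𝓝 f) (𝓝 0) := by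
      simpa using (continuous_const.edist continuous_id : Continuous fun g => edist f g).tendsto f
    simpa using ((((ENNReal.tendsto_toReal ENNReal.zero_ne_top).comp h1).const_mul A).div_const
      (1 - R))
  rw [Metric.tendstoUniformlyOn_iff]
  intro ε hε
  filter_upwards [hlim.eventually_lt_const hε, Metric.eball_mem_nhds f one_pos] with g hg hfg z hz
  have hne : edist f g ≠ ⊤ := by
    rw [edist_comm]; exact (lt_trans (Metric.mem_eball.1 hfg) ENNReal.one_lt_top).ne
  refine lt_of_le_of_lt ?_ hg
  have hbd : ∀ n, ‖coeff (T f - T g) n‖ ≤ A * (edist f g).toReal := fun n => by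
    rw [coeff_sub]; exact hT f g hne n
  have h0 : 0 ≤ A * (edist f g).toReal := (norm_nonneg _).trans (hbd 0)
  have h := norm_le_of_coeff_bounded hbd z
  rw [dist_eq_norm]
  refine le_trans h ?_
  have := hR z hz
  exact div_le_div_of_nonneg_left h0 (by linarith) (by linarith)

/-- The Hilbert operator on a space of holomorphic functions whose metric controls the block
condition with exponent `β < s`. -/
theorem hilbertOp_spec {μ : Measure Interval} [IsFiniteMeasure μ] {s β : ℝ}
    (hμ : IsCarleson μ s) (hβ : 0 < β) (hβs : β < s) {X : Type*} [PseudoEMetricSpace X]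
    (toHol : X → HolDisc) {K : ℝ} (hX : ∀ f, ∃ N, BlockBounded β N (coeff (toHol f)))
    (hK : ∀ f g, edist f g ≠ ⊤ →
      BlockBounded β (K * (edist f g).toReal) (coeff (toHol f) - coeff (toHol g))) :
    (∀ f, IsHilbertImage μ (toHol f) (hilbertOp μ (toHol f))) ∧
    (∀ f, IsIntegralImage μ (toHol f) (hilbertOp μ (toHol f))) ∧
    (∀ (a b : ℂ) (f g h : X), toHol h = a • toHol f + b • toHol g →
      hilbertOp μ (toHol h) = a • hilbertOp μ (toHol f) + b • hilbertOp μ (toHol g)) ∧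
    (∀ f, ∃ M, ∀ n, ‖coeff (hilbertOp μ (toHol f)) n‖ ≤ M) ∧
    ∃ A, 0 ≤ A ∧ ∀ f g, edist f g ≠ ⊤ → ∀ n,
      ‖coeff (hilbertOp μ (toHol f)) n - coeff (hilbertOp μ (toHol g)) n‖ ≤
        A * (edist f g).toReal := by
  obtain ⟨A, hA0, hA⟩ := exists_hilbert_bound hμ hβ hβs
  have hsumm : ∀ f n, Summable fun k : ℕ => (moment μ (n + k) : ℂ) * coeff (toHol f) k :=
    fun f n => let ⟨N, hN⟩ := hX f; (hA _ N hN).1 n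
  have hbd : ∀ f, ∃ M, ∀ n, ‖hilbertCoeff μ (toHol f) n‖ ≤ M :=
    fun f => let ⟨N, hN⟩ := hX f; ⟨_, (hA _ N hN).2.1⟩
  have hco : ∀ f, coeff (hilbertOp μ (toHol f)) = hilbertCoeff μ (toHol f) :=
    fun f => let ⟨_, hM⟩ := hbd f; coeff_hilbertOp hM
  -- Stated for combinations in `HolDisc`, because `X` carries no vector space structure; this also
  -- covers differences, which need not come from `X`.
  have hlin : ∀ (a b : ℂ) (f g : X), hilbertCoeff μ (a • toHol f + b • toHol g) =
      a • hilbertCoeff μ (toHol f) + b • hilbertCoeff μ (toHol g) := fun a b f g => by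
    funext n
    have h := ((hsumm f n).hasSum.mul_left a).add ((hsumm g n).hasSum.mul_left b)
    rw [hilbertCoeff, coeff_smul_add_smul]
    refine (h.congr_fun fun k => ?_).tsum_eq
    simp only [Pi.add_apply, Pi.smul_apply, smul_eq_mul]
    ring
  refine ⟨fun f => ⟨hsumm f, fun z => ?_⟩, fun f z => ?_, fun a b f g h hh => ?_, fun f => ?_,
    A * |K|, by positivity, fun f g hfg n => ?_⟩
  · have := hasSum_coeff (hilbertOp μ (toHol f)) z
    rwa [hco] at this
  · obtain ⟨N, hN⟩ := hX f
    obtain ⟨h1, h2⟩ := (hA _ N hN).2.2 z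
    have := hasSum_coeff (hilbertOp μ (toHol f)) z
    rw [hco] at this
    exact ⟨h1, this.unique h2⟩
  · apply HolDisc.ext_coeff
    rw [coeff_smul_add_smul, hco, hco, hco, hh, hlin]
  · rw [hco]; exact hbd f
  · have h1 := hlin 1 (-1) f g
    have h3 := (hA (toHol f - toHol g) _ (coeff_sub (toHol f) (toHol g) ▸ hK f g hfg)).2.1 n
    rw [HolDisc.sub_eq_smul_add_smul, h1] at h3
    simp only [one_smul, neg_smul, ← sub_eq_add_neg, Pi.sub_apply] at h3
    rw [hco, hco]
    refine h3.trans ?_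
    rw [mul_assoc]
    gcongr
    exact le_abs_self K

/-! ### Rudin–Shapiro coefficients -/

/-- The coefficients of the `n`-th pair of Rudin–Shapiro polynomials. -/
def rudinShapiro : ℕ → (ℕ → ℂ) × (ℕ → ℂ)
  | 0 => (fun _ => 1, fun _ => 1)
  | n + 1 => (fun m => if m < 2 ^ n then (rudinShapiro n).1 m else (rudinShapiro n).2 (m - 2 ^ n),
      fun m => if m < 2 ^ n then (rudinShapiro n).1 m else -(rudinShapiro n).2 (m - 2 ^ n))

theorem norm_rudinShapiro (n : ℕ) :
    ∀ m, ‖(rudinShapiro n).1 m‖ = 1 ∧ ‖(rudinShapiro n).2 m‖ = 1 := by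
  induction n with
  | zero => simp [rudinShapiro]
  | succ n ih =>
    intro m
    simp only [rudinShapiro]
    split_ifs
    · exact ⟨(ih m).1, (ih m).1⟩
    · exact ⟨(ih _).2, by rw [norm_neg]; exact (ih _).2⟩

theorem sum_ite_lt_mul_pow (u v : ℕ → ℂ) (N : ℕ) (z : ℂ) :
    ∑ m ∈ Finset.range (N + N), (if m < N then u m else v (m - N)) * z ^ m =
      ∑ m ∈ Finset.range N, u m * z ^ m + z ^ N * ∑ m ∈ Finset.range N, v m * z ^ m := by
  rw [Finset.sum_range_add, Finset.mul_sum]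
  congr 1
  · exact Finset.sum_congr rfl fun m hm => by rw [if_pos (Finset.mem_range.1 hm)]
  · refine Finset.sum_congr rfl fun m _ => ?_
    rw [if_neg (by omega), Nat.add_sub_cancel_left, pow_add]
    ring

/-- The next pair is `P ± z^(2^n) Q`, so the parallelogram law doubles the sum of squares; off the
unit circle the factor `z^(2^n)` only makes it smaller. -/
theorem norm_sq_rudinShapiro_add_le (n : ℕ) {z : ℂ} (hz : ‖z‖ ≤ 1) :
    ‖∑ m ∈ Finset.range (2 ^ n), (rudinShapiro n).1 m * z ^ m‖ ^ 2 +
      ‖∑ m ∈ Finset.range (2 ^ n), (rudinShapiro n).2 m * z ^ m‖ ^ 2 ≤ 2 ^ (n + 1) := by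
  induction n with
  | zero => norm_num [rudinShapiro]
  | succ n ih =>
    have h2 : 2 ^ (n + 1) = 2 ^ n + 2 ^ n := by ring
    set P := ∑ m ∈ Finset.range (2 ^ n), (rudinShapiro n).1 m * z ^ m with hP
    set Q := ∑ m ∈ Finset.range (2 ^ n), (rudinShapiro n).2 m * z ^ m with hQ
    have e1 : ∑ m ∈ Finset.range (2 ^ (n + 1)), (rudinShapiro (n + 1)).1 m * z ^ m =
        P + z ^ (2 ^ n) * Q := by
      rw [h2, hP, hQ, ← sum_ite_lt_mul_pow]
      rfl
    have e2 : ∑ m ∈ Finset.range (2 ^ (n + 1)), (rudinShapiro (n + 1)).2 m * z ^ m =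
        P - z ^ (2 ^ n) * Q := by
      have := sum_ite_lt_mul_pow (rudinShapiro n).1 (fun m => -(rudinShapiro n).2 m) (2 ^ n) z
      simp only [neg_mul, Finset.sum_neg_distrib, mul_neg, ← sub_eq_add_neg] at this
      rw [h2, hP, hQ, ← this]
      rfl
    have hpar := parallelogram_law_with_norm ℂ P (z ^ (2 ^ n) * Q)
    have hQle : ‖z ^ (2 ^ n) * Q‖ ≤ ‖Q‖ := by
      rw [norm_mul, norm_pow]
      exact mul_le_of_le_one_left (norm_nonneg _) (pow_le_one₀ (norm_nonneg _) hz)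
    have hQsq := pow_le_pow_left₀ (norm_nonneg _) hQle 2
    rw [e1, e2, pow_succ 2 (n + 1)]
    linarith

theorem norm_rudinShapiro_sum_le (n : ℕ) {z : ℂ} (hz : ‖z‖ ≤ 1) :
    ‖∑ m ∈ Finset.range (2 ^ n), (rudinShapiro n).1 m * z ^ m‖ ≤
      √2 * ((2 : ℝ) ^ n) ^ (1 / 2 : ℝ) := by
  rw [← Real.sqrt_eq_rpow, ← Real.sqrt_mul (by norm_num), ← pow_succ']
  refine Real.le_sqrt_of_sq_le ?_
  have := norm_sq_rudinShapiro_add_le n hz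
  nlinarith [sq_nonneg ‖∑ m ∈ Finset.range (2 ^ n), (rudinShapiro n).2 m * z ^ m‖]

/-- A unimodular sequence whose dyadic blocks are Rudin–Shapiro polynomials. -/
def rudinShapiroSeq (m : ℕ) : ℂ :=
  (rudinShapiro (Nat.log 2 m)).1 (m - 2 ^ Nat.log 2 m)

theorem norm_rudinShapiroSeq (m : ℕ) : ‖rudinShapiroSeq m‖ = 1 := (norm_rudinShapiro _ _).1

theorem sum_block_rudinShapiroSeq (j : ℕ) (z : ℂ) :
    ∑ m ∈ Finset.Ico (2 ^ j) (2 ^ (j + 1)), rudinShapiroSeq m * z ^ m =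
      z ^ (2 ^ j) * ∑ m ∈ Finset.range (2 ^ j), (rudinShapiro j).1 m * z ^ m := by
  rw [Finset.sum_Ico_eq_sum_range, Finset.mul_sum]
  have h2 : 2 ^ (j + 1) - 2 ^ j = 2 ^ j := by rw [pow_succ]; omega
  rw [h2]
  refine Finset.sum_congr rfl fun m hm => ?_
  have hm' := Finset.mem_range.1 hm
  have hlog : Nat.log 2 (2 ^ j + m) = j :=
    Nat.log_eq_of_pow_le_of_lt_pow (by omega) (by rw [pow_succ]; omega)
  rw [rudinShapiroSeq, hlog, Nat.add_sub_cancel_left, pow_add]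
  ring

/-- The `j`-th block is at most `√2 * 2^(j/2) * |z|^(2^j)`. As `γ ≥ 1/2`, the factor `2^(j/2)` is at
most `2^(jγ)`, and the dyadic sum yields `(1-|z|)^(-γ)`. -/
theorem smul_rudinShapiroSeq_mem {γ : ℝ} (hγ : 1 / 2 ≤ γ) (c : ℂ) :
    c • rudinShapiroSeq ∈ weightedSeq γ := by
  obtain ⟨C, hC0, hC⟩ := exists_dyadic_sum_le (β := γ) (by linarith)
  have hb : ∀ z : ℂ, ‖z‖ < 1 → Summable fun n => (c • rudinShapiroSeq) n * z ^ n :=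
    summable_mul_pow_of_bounded (C := ‖c‖) fun n => by simp [norm_rudinShapiroSeq]
  refine ⟨HolDisc.ofSeries _ hb, ⟨‖c‖ * (1 + √2 * C), ?_⟩, coeff_ofSeries _ hb⟩
  rintro _ ⟨z, rfl⟩
  have hz := z.norm_lt_one
  set r := ‖(z : ℂ)‖ with hr
  have hr0 : 0 ≤ r := norm_nonneg _
  have hx : 0 < 1 - r := by linarith
  have hone : 1 ≤ (1 - r) ^ (-γ) :=
    Real.one_le_rpow_of_pos_of_le_one_of_nonpos hx (by linarith) (by linarith)
  have hpart : ∀ J : ℕ, ‖∑ m ∈ Finset.range (2 ^ J), (c • rudinShapiroSeq) m * (z : ℂ) ^ m‖ ≤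
      ‖c‖ * (1 + √2 * C) * (1 - r) ^ (-γ) := by
    intro J
    simp only [Pi.smul_apply, smul_eq_mul, mul_assoc c]
    rw [← Finset.mul_sum, norm_mul, mul_assoc, sum_range_two_pow]
    refine mul_le_mul_of_nonneg_left ?_ (norm_nonneg _)
    refine (norm_add_le _ _).trans ?_
    rw [add_mul]
    refine add_le_add (by simpa [norm_rudinShapiroSeq] using hone) ?_
    refine (norm_sum_le _ _).trans ?_
    rw [mul_assoc]
    refine le_trans ?_ (mul_le_mul_of_nonneg_left (hC r hr0 hz J) (Real.sqrt_nonneg 2))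
    rw [Finset.mul_sum]
    refine Finset.sum_le_sum fun j _ => ?_
    rw [sum_block_rudinShapiroSeq, norm_mul, norm_pow, mul_comm, ← mul_assoc]
    refine mul_le_mul_of_nonneg_right ?_ (by positivity)
    refine (norm_rudinShapiro_sum_le j hz.le).trans ?_
    exact mul_le_mul_of_nonneg_left
      (Real.rpow_le_rpow_of_exponent_le (one_le_pow₀ one_le_two) hγ) (Real.sqrt_nonneg 2)
  -- The power series converges, so bounds on the partial sums of length `2^J` suffice.
  have hlim := ((HolDisc.hasSum_ofSeries _ hb z).tendsto_sum_nat.comp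
    (tendsto_pow_atTop_atTop_of_one_lt (one_lt_two (α := ℕ)))).norm
  have h := le_of_tendsto hlim (Eventually.of_forall hpart)
  rw [Real.rpow_neg hx.le, ← div_eq_mul_inv, le_div_iff₀ (by positivity)] at h
  exact (mul_comm _ _).trans_le h

/-! ### The solid hull -/

theorem rpow_block_le {γ : ℝ} (hγ : 0 ≤ γ) {j m : ℕ}
    (hm : m ∈ Finset.Ico (2 ^ j) (2 ^ (j + 1))) :
    ((2 : ℝ) ^ j) ^ γ ≤ ((m : ℝ) + 1) ^ γ ∧
      ((m : ℝ) + 1) ^ γ ≤ (2 : ℝ) ^ γ * ((2 : ℝ) ^ j) ^ γ := by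
  obtain ⟨h1, h2⟩ := Finset.mem_Ico.1 hm
  have h1' : (2 : ℝ) ^ j ≤ m := by exact_mod_cast h1
  have h2' : (m : ℝ) + 1 ≤ 2 * 2 ^ j := by rw [← pow_succ']; exact_mod_cast h2
  rw [← Real.mul_rpow two_pos.le (by positivity)]
  exact ⟨Real.rpow_le_rpow (by positivity) (by linarith) hγ,
    Real.rpow_le_rpow (by positivity) h2' hγ⟩

theorem card_block (j : ℕ) : (Finset.Ico (2 ^ j) (2 ^ (j + 1))).card = 2 ^ j := by
  rw [Nat.card_Ico, pow_succ]; omega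

theorem rpow_two_mul_eq_sq {x : ℝ} (hx : 0 ≤ x) (γ : ℝ) : x ^ (2 * γ) = (x ^ γ) ^ 2 := by
  rw [mul_comm, Real.rpow_mul hx, Real.rpow_two]

/-- Cauchy–Schwarz on the block: its `2^j` indices give the extra `1/2` in the exponent, and `m + 1
≤ 2 * 2^j` gives the factor `2^γ`. -/
theorem blockBounded_of_hullNorm {γ : ℝ} (hγ : 0 ≤ γ) {a : ℕ → ℂ} (ha : hullNorm γ a ≠ ⊤) :
    BlockBounded (γ + 1 / 2) (2 ^ γ * (hullNorm γ a).toReal) a := by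
  have h2γ : 1 ≤ (2 : ℝ) ^ γ := Real.one_le_rpow one_le_two hγ
  refine ⟨?_, fun j => ?_⟩
  · have h : ENNReal.ofReal ‖a 0‖ ≤ hullNorm γ a := le_sup_left
    exact ((ENNReal.ofReal_le_iff_le_toReal ha).1 h).trans
      (le_mul_of_one_le_left ENNReal.toReal_nonneg h2γ)
  · have h : √(∑ m ∈ Finset.Ico (2 ^ j) (2 ^ (j + 1)), ‖a m‖ ^ 2 / ((m : ℝ) + 1) ^ (2 * γ)) ≤
        (hullNorm γ a).toReal := (ENNReal.ofReal_le_iff_le_toReal ha).1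
      ((le_iSup (fun n : ℕ => ENNReal.ofReal (√(∑ m ∈ Finset.Ico (2 ^ n) (2 ^ (n + 1)),
        ‖a m‖ ^ 2 / ((m : ℝ) + 1) ^ (2 * γ)))) j).trans le_sup_right)
    have hcs := Real.sum_mul_le_sqrt_mul_sqrt (Finset.Ico (2 ^ j) (2 ^ (j + 1)))
      (fun m => ‖a m‖ / ((m : ℝ) + 1) ^ γ) (fun m => ((m : ℝ) + 1) ^ γ)
    have e1 : ∀ m : ℕ, ‖a m‖ / ((m : ℝ) + 1) ^ γ * ((m : ℝ) + 1) ^ γ = ‖a m‖ := fun m =>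
      div_mul_cancel₀ _ (by positivity)
    have e2 : ∀ m : ℕ, (‖a m‖ / ((m : ℝ) + 1) ^ γ) ^ 2 =
        ‖a m‖ ^ 2 / ((m : ℝ) + 1) ^ (2 * γ) := fun m => by
      rw [div_pow, rpow_two_mul_eq_sq (by positivity)]
    simp only [e1, e2] at hcs
    have h3 : √(∑ m ∈ Finset.Ico (2 ^ j : ℕ) (2 ^ (j + 1)), (((m : ℝ) + 1) ^ γ) ^ 2) ≤
        (2 : ℝ) ^ γ * ((2 : ℝ) ^ j) ^ (γ + 1 / 2) := by
      refine Real.sqrt_le_iff.2 ⟨by positivity, ?_⟩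
      refine (Finset.sum_le_card_nsmul _ _ (((2 : ℝ) ^ γ * ((2 : ℝ) ^ j) ^ γ) ^ 2) fun m hm =>
        pow_le_pow_left₀ (by positivity) (rpow_block_le hγ hm).2 2).trans_eq ?_
      rw [card_block, nsmul_eq_mul, Real.rpow_add (by positivity), ← Real.sqrt_eq_rpow, mul_pow,
        mul_pow, mul_pow, Real.sq_sqrt (by positivity)]
      push_cast
      ring
    refine hcs.trans ((mul_le_mul h h3 (Real.sqrt_nonneg _) ENNReal.toReal_nonneg).trans_eq ?_)
    ring

theorem half_le_one_sub_pow (j : ℕ) : (1 : ℝ) / 2 ≤ (1 - (2 ^ (j + 1))⁻¹) ^ (2 ^ j) := by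
  have h1 : ((2 : ℝ) ^ (j + 1))⁻¹ ≤ 1 := inv_le_one_of_one_le₀ (one_le_pow₀ one_le_two)
  have h := one_add_mul_le_pow (a := -((2 : ℝ) ^ (j + 1))⁻¹) (by linarith) (2 ^ j)
  rw [← sub_eq_add_neg] at h
  refine le_trans (le_of_eq ?_) h
  rw [pow_succ]
  push_cast
  field_simp
  norm_num

/-- By Bernoulli, `r = 1 - 2^(-(j+1))` satisfies `r^(2^j) ≥ 1/2`; squaring covers the whole block.
At this radius `r^m` can be dropped at the cost of a factor `4`. -/
theorem quarter_le_one_sub_pow {j m : ℕ} (hm : m ∈ Finset.Ico (2 ^ j) (2 ^ (j + 1))) :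
    (1 : ℝ) / 4 ≤ (1 - (2 ^ (j + 1))⁻¹) ^ m := by
  have h1 : ((2 : ℝ) ^ (j + 1))⁻¹ ≤ 1 := inv_le_one_of_one_le₀ (one_le_pow₀ one_le_two)
  have h2 : 0 ≤ ((2 : ℝ) ^ (j + 1))⁻¹ := by positivity
  calc (1 : ℝ) / 4 = (1 / 2) ^ 2 := by norm_num
    _ ≤ ((1 - (2 ^ (j + 1))⁻¹) ^ (2 ^ j)) ^ 2 :=
        pow_le_pow_left₀ (by norm_num) (half_le_one_sub_pow j) 2
    _ = (1 - (2 ^ (j + 1))⁻¹) ^ (2 ^ (j + 1)) := by rw [← pow_mul, ← pow_succ]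
    _ ≤ _ := pow_le_pow_of_le_one (by linarith) (by linarith) (Finset.mem_Ico.1 hm).2.le

/-- Functions in `H^∞_{v_γ}` are bounded by a multiple of `(2^j)^γ` on the circle of radius
`1 - 2^{-(j+1)}`. -/
theorem norm_le_on_circle {γ M : ℝ} {f : HolDisc}
    (hM : ∀ z : Disc, (1 - ‖(z : ℂ)‖) ^ γ * ‖f.1 z‖ ≤ M) (j : ℕ) (z : Disc)
    (hz : ‖(z : ℂ)‖ = 1 - (2 ^ (j + 1))⁻¹) : ‖f.1 z‖ ≤ M * ((2 : ℝ) ^ γ * ((2 : ℝ) ^ j) ^ γ) := by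
  have h := hM z
  rw [hz, sub_sub_cancel, Real.inv_rpow (by positivity), inv_mul_le_iff₀ (by positivity)] at h
  rw [← Real.mul_rpow two_pos.le (by positivity), ← pow_succ']
  linarith

theorem radius_nonneg (j : ℕ) : (0 : ℝ) ≤ 1 - (2 ^ (j + 1))⁻¹ :=
  sub_nonneg.2 (inv_le_one_of_one_le₀ (one_le_pow₀ one_le_two))

theorem radius_lt_one (j : ℕ) : (1 : ℝ) - (2 ^ (j + 1))⁻¹ < 1 :=
  sub_lt_self _ (by positivity)

/-- Parseval at radius `1 - 2^(-(j+1))` bounds the block of the dominating function; `16` is the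
square of the loss `4` from dropping `r^m`. -/
theorem hullNorm_ne_top {γ : ℝ} (hγ : 0 ≤ γ) {c : ℕ → ℂ} (hc : c ∈ solidHull (weightedSeq γ)) :
    hullNorm γ c ≠ ⊤ := by
  obtain ⟨_, ⟨f, ⟨M, hM⟩, rfl⟩, hcf⟩ := hc
  have hM' : ∀ z : Disc, (1 - ‖(z : ℂ)‖) ^ γ * ‖f.1 z‖ ≤ M := fun z => hM ⟨z, rfl⟩
  refine ne_top_of_le_ne_top (b := ENNReal.ofReal ‖c 0‖ ⊔ ENNReal.ofReal √(16 * (M * 2 ^ γ) ^ 2))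
    (max_lt ENNReal.ofReal_lt_top ENNReal.ofReal_lt_top).ne
    (sup_le_sup_left (iSup_le fun j => ENNReal.ofReal_le_ofReal (Real.sqrt_le_sqrt ?_)) _)
  have hP := sum_sq_norm_coeff_le f (radius_nonneg j) (radius_lt_one j)
    (norm_le_on_circle hM' j) (Finset.Ico (2 ^ j) (2 ^ (j + 1)))
  have hpos : 0 < ((2 : ℝ) ^ j) ^ γ := by positivity
  calc ∑ m ∈ Finset.Ico (2 ^ j) (2 ^ (j + 1)), ‖c m‖ ^ 2 / ((m : ℝ) + 1) ^ (2 * γ)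
      ≤ ∑ m ∈ Finset.Ico (2 ^ j) (2 ^ (j + 1)),
          16 / (((2 : ℝ) ^ j) ^ γ) ^ 2 * (‖coeff f m‖ * (1 - (2 ^ (j + 1))⁻¹) ^ m) ^ 2 := by
        refine Finset.sum_le_sum fun m hm => ?_
        have h1 : ‖c m‖ ≤ 4 * (‖coeff f m‖ * (1 - (2 ^ (j + 1))⁻¹) ^ m) := by
          refine (hcf m).trans ?_
          nlinarith [quarter_le_one_sub_pow hm, norm_nonneg (coeff f m)]
        rw [rpow_two_mul_eq_sq (by positivity), div_mul_eq_mul_div]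
        refine div_le_div₀ (by positivity) ?_ (by positivity)
          (pow_le_pow_left₀ hpos.le (rpow_block_le hγ hm).1 2)
        refine (pow_le_pow_left₀ (norm_nonneg _) h1 2).trans_eq ?_
        ring
    _ ≤ 16 / (((2 : ℝ) ^ j) ^ γ) ^ 2 * (M * ((2 : ℝ) ^ γ * ((2 : ℝ) ^ j) ^ γ)) ^ 2 := by
        rw [← Finset.mul_sum]
        exact mul_le_mul_of_nonneg_left hP (by positivity)
    _ = 16 * (M * 2 ^ γ) ^ 2 := by field_simp

/-- A block has `2^j` terms, each at most `M^2 / 2^j` because `2γ ≥ 1`. -/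
theorem hullNorm_le_of_bounded {γ M : ℝ} (hγ : 1 / 2 ≤ γ) {b : ℕ → ℂ} (hb : ∀ n, ‖b n‖ ≤ M) :
    hullNorm γ b ≤ ENNReal.ofReal M := by
  have hM : 0 ≤ M := (norm_nonneg _).trans (hb 0)
  refine sup_le (ENNReal.ofReal_le_ofReal (hb 0)) (iSup_le fun j => ENNReal.ofReal_le_ofReal
    (Real.sqrt_le_iff.2 ⟨hM, ?_⟩))
  refine (Finset.sum_le_card_nsmul _ _ (M ^ 2 / (2 : ℝ) ^ j) fun m hm => ?_).trans_eq ?_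
  · refine div_le_div₀ (by positivity) (pow_le_pow_left₀ (norm_nonneg _) (hb m) 2)
      (by positivity) ?_
    refine le_trans ?_ (rpow_block_le (γ := 2 * γ) (by linarith) hm).1
    exact Real.self_le_rpow_of_one_le (one_le_pow₀ one_le_two) (by linarith)
  · rw [card_block, nsmul_eq_mul]
    push_cast
    field_simp

theorem mem_solidHull_of_bounded {γ M : ℝ} (hγ : 1 / 2 ≤ γ) {b : ℕ → ℂ} (hb : ∀ n, ‖b n‖ ≤ M) :
    b ∈ solidHull (weightedSeq γ) :=
  ⟨_, smul_rudinShapiroSeq_mem hγ (M : ℂ), fun n => by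
    simpa [norm_rudinShapiroSeq] using (hb n).trans (le_abs_self M)⟩

/-! ### The solid core -/

theorem blockBounded_of_coreNorm {γ : ℝ} (hγ : 0 ≤ γ) {a : ℕ → ℂ} (ha : coreNorm γ a ≠ ⊤) :
    BlockBounded γ (2 ^ γ * (coreNorm γ a).toReal) a := by
  have h2γ : 1 ≤ (2 : ℝ) ^ γ := Real.one_le_rpow one_le_two hγ
  refine ⟨?_, fun j => ?_⟩
  · have h : ENNReal.ofReal ‖a 0‖ ≤ coreNorm γ a := le_sup_left
    exact ((ENNReal.ofReal_le_iff_le_toReal ha).1 h).trans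
      (le_mul_of_one_le_left ENNReal.toReal_nonneg h2γ)
  · have h : ∑ m ∈ Finset.Ico (2 ^ j) (2 ^ (j + 1)), ‖a m‖ / ((m : ℝ) + 1) ^ γ ≤
        (coreNorm γ a).toReal := (ENNReal.ofReal_le_iff_le_toReal ha).1
      ((le_iSup (fun n : ℕ => ENNReal.ofReal (∑ m ∈ Finset.Ico (2 ^ n) (2 ^ (n + 1)),
        ‖a m‖ / ((m : ℝ) + 1) ^ γ)) j).trans le_sup_right)
    calc ∑ m ∈ Finset.Ico (2 ^ j) (2 ^ (j + 1)), ‖a m‖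
        ≤ ∑ m ∈ Finset.Ico (2 ^ j) (2 ^ (j + 1)),
            ‖a m‖ / ((m : ℝ) + 1) ^ γ * ((2 : ℝ) ^ γ * ((2 : ℝ) ^ j) ^ γ) := by
          refine Finset.sum_le_sum fun m hm => ?_
          rw [div_mul_eq_mul_div, le_div_iff₀ (by positivity)]
          exact mul_le_mul_of_nonneg_left (rpow_block_le hγ hm).2 (norm_nonneg _)
      _ ≤ (coreNorm γ a).toReal * ((2 : ℝ) ^ γ * ((2 : ℝ) ^ j) ^ γ) := by
          rw [← Finset.sum_mul]
          exact mul_le_mul_of_nonneg_right h (by positivity)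
      _ = _ := by ring

/-- Multiplying by the unimodular conjugate phases, a bounded sequence, turns `c` into `|c|`. The
value at the real point `r = 1 - 2^(-(j+1))` is then a sum of nonnegative terms and bounds each
block. -/
theorem coreNorm_ne_top {γ : ℝ} (hγ : 0 ≤ γ) {c : ℕ → ℂ} (hc : c ∈ solidCore (weightedSeq γ)) :
    coreNorm γ c ≠ ⊤ := by
  -- Where `c n = 0` the quotient is `0`, which is harmless since the product vanishes anyway.
  obtain ⟨f, ⟨M, hM⟩, hf⟩ := hc (fun n => (starRingEnd ℂ) (c n) / ‖c n‖) <|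
    memℓp_infty ⟨1, by
      rintro _ ⟨n, rfl⟩
      simpa using div_self_le_one ‖c n‖⟩
  have hM' : ∀ z : Disc, (1 - ‖(z : ℂ)‖) ^ γ * ‖f.1 z‖ ≤ M := fun z => hM ⟨z, rfl⟩
  have hfc : ∀ n, coeff f n = (‖c n‖ : ℂ) := fun n => by
    rw [hf]
    by_cases h : c n = 0
    · simp [h]
    · have : (‖c n‖ : ℂ) ≠ 0 := by simpa using h
      dsimp only
      rw [← mul_div_assoc, Complex.mul_conj, Complex.normSq_eq_norm_sq, div_eq_iff this]
      push_cast
      ring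
  refine ne_top_of_le_ne_top (b := ENNReal.ofReal ‖c 0‖ ⊔ ENNReal.ofReal (4 * (M * 2 ^ γ)))
    (max_lt ENNReal.ofReal_lt_top ENNReal.ofReal_lt_top).ne
    (sup_le_sup_left (iSup_le fun j => ENNReal.ofReal_le_ofReal ?_) _)
  set r : ℝ := 1 - (2 ^ (j + 1))⁻¹ with hr
  have hr0 : 0 ≤ r := radius_nonneg j
  have hr1 : r < 1 := radius_lt_one j
  have hrn : ‖(r : ℂ)‖ = r := by simp [abs_of_nonneg hr0]
  have hsum : ∑ m ∈ Finset.Ico (2 ^ j) (2 ^ (j + 1)), ‖c m‖ * r ^ m ≤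
      M * ((2 : ℝ) ^ γ * ((2 : ℝ) ^ j) ^ γ) := by
    have h1 := hasSum_coeff f ⟨(r : ℂ), by rw [mem_ball_zero_iff, hrn]; exact hr1⟩
    have h2 := norm_le_on_circle hM' j ⟨(r : ℂ), by rw [mem_ball_zero_iff, hrn]; exact hr1⟩ hrn
    have h3 := Complex.hasSum_re h1
    simp only [hfc, ← Complex.ofReal_pow, ← Complex.ofReal_mul, Complex.ofReal_re] at h3
    exact (sum_le_hasSum _ (fun m _ => by positivity) h3).trans
      ((Complex.re_le_norm _).trans h2)
  have hpos : 0 < ((2 : ℝ) ^ j) ^ γ := by positivity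
  calc ∑ m ∈ Finset.Ico (2 ^ j) (2 ^ (j + 1)), ‖c m‖ / ((m : ℝ) + 1) ^ γ
      ≤ ∑ m ∈ Finset.Ico (2 ^ j) (2 ^ (j + 1)), 4 / ((2 : ℝ) ^ j) ^ γ * (‖c m‖ * r ^ m) := by
        refine Finset.sum_le_sum fun m hm => ?_
        rw [div_mul_eq_mul_div]
        refine div_le_div₀ (by positivity) ?_ hpos (rpow_block_le hγ hm).1
        nlinarith [quarter_le_one_sub_pow hm, norm_nonneg (c m)]
    _ ≤ 4 / ((2 : ℝ) ^ j) ^ γ * (M * ((2 : ℝ) ^ γ * ((2 : ℝ) ^ j) ^ γ)) := by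
        rw [← Finset.mul_sum]
        exact mul_le_mul_of_nonneg_left hsum (by positivity)
    _ = 4 * (M * 2 ^ γ) := by field_simp

theorem coreNorm_le_of_bounded {γ M : ℝ} (hγ : 1 ≤ γ) {b : ℕ → ℂ} (hb : ∀ n, ‖b n‖ ≤ M) :
    coreNorm γ b ≤ ENNReal.ofReal M := by
  have hM : 0 ≤ M := (norm_nonneg _).trans (hb 0)
  refine sup_le (ENNReal.ofReal_le_ofReal (hb 0)) (iSup_le fun j => ENNReal.ofReal_le_ofReal ?_)
  refine (Finset.sum_le_card_nsmul _ _ (M / (2 : ℝ) ^ j) fun m hm => ?_).trans_eq ?_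
  · refine div_le_div₀ hM (hb m) (by positivity) ?_
    refine le_trans ?_ (rpow_block_le (by linarith) hm).1
    exact Real.self_le_rpow_of_one_le (one_le_pow₀ one_le_two) hγ
  · rw [card_block, nsmul_eq_mul]
    push_cast
    field_simp

theorem mem_weightedSeq_of_bounded {γ M : ℝ} (hγ : 1 ≤ γ) {b : ℕ → ℂ} (hb : ∀ n, ‖b n‖ ≤ M) :
    b ∈ weightedSeq γ := by
  have hM : 0 ≤ M := (norm_nonneg _).trans (hb 0)
  refine ⟨HolDisc.ofSeries b (summable_mul_pow_of_bounded hb), ⟨M, ?_⟩, coeff_ofSeries _ _⟩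
  rintro _ ⟨z, rfl⟩
  have hx : 0 < 1 - ‖(z : ℂ)‖ := by linarith [z.norm_lt_one]
  have h := norm_le_of_coeff_bounded
    (f := HolDisc.ofSeries b (summable_mul_pow_of_bounded hb)) (C := M)
    (by rwa [coeff_ofSeries]) z
  have hx1 : (1 - ‖(z : ℂ)‖) ^ γ ≤ 1 - ‖(z : ℂ)‖ := by
    have := Real.rpow_le_rpow_of_exponent_ge hx (by linarith [norm_nonneg (z : ℂ)]) hγ
    rwa [Real.rpow_one] at this
  refine (mul_le_mul hx1 h (norm_nonneg _) hx.le).trans_eq ?_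
  field_simp

theorem mem_solidCore_of_bounded {γ M : ℝ} (hγ : 1 ≤ γ) {b : ℕ → ℂ} (hb : ∀ n, ‖b n‖ ≤ M) :
    b ∈ solidCore (weightedSeq γ) := by
  intro c hc
  obtain ⟨D, hD⟩ := hc.bddAbove
  refine mem_weightedSeq_of_bounded hγ (M := M * D) fun n => ?_
  rw [norm_mul]
  exact mul_le_mul (hb n) (hD ⟨n, rfl⟩) (norm_nonneg _) ((norm_nonneg _).trans (hb n))

/-! ### Continuity of the self-maps and the two cases of the theorem. -/

theorem continuous_of_edist_le {X Y : Type*} [PseudoEMetricSpace X] [PseudoEMetricSpace Y]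
    {T : X → Y} {A : ℝ} (hA : 0 ≤ A)
    (hT : ∀ f g, edist f g ≠ ⊤ → edist (T f) (T g) ≤ ENNReal.ofReal (A * (edist f g).toReal)) :
    Continuous T := by
  -- With `A + 1` the constant is nonzero even if `A = 0`, so the Lipschitz bound is trivially `⊤`
  -- at infinite distance.
  have h : LipschitzWith (A + 1).toNNReal T := by
    intro f g
    by_cases h : edist f g = ⊤
    · have hA1 : ((A + 1).toNNReal : ℝ≥0∞) ≠ 0 := by
        simpa using add_pos_of_nonneg_of_pos hA one_pos
      rw [h, ENNReal.mul_top hA1]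
      exact le_top
    · refine (hT f g h).trans ?_
      rw [ENNReal.ofReal_mul hA, ENNReal.ofReal_toReal h]
      exact mul_le_mul_left (ENNReal.ofReal_le_ofReal (by linarith)) _
  exact h.continuous

end HilbertOp

end

theorem mainTheorem12 (γ s : ℝ) (hγ : 0 < γ) (hs : 0 < s)
    (μ : MeasureTheory.Measure HilbertOp.Interval) [MeasureTheory.IsFiniteMeasure μ]
    (hμ : HilbertOp.IsCarleson μ s) :
    (γ + 1 / 2 < s →
      ∃ T : HilbertOp.HullSpace γ → HilbertOp.HolDisc,
        (∀ f, HilbertOp.IsHilbertImage μ f.toHol (T f)) ∧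
        (∀ f, HilbertOp.IsIntegralImage μ f.toHol (T f)) ∧
        (∀ (α β : ℂ) (f g h : HilbertOp.HullSpace γ),
          h.toHol = α • f.toHol + β • g.toHol → T h = α • T f + β • T g) ∧
        Continuous T ∧
        (1 / 2 ≤ γ → ∃ T' : HilbertOp.HullSpace γ → HilbertOp.HullSpace γ,
          (∀ f, (T' f).toHol = T f) ∧ Continuous T')) ∧
    (γ < s →
      ∃ T : HilbertOp.CoreSpace γ → HilbertOp.HolDisc,
        (∀ f, HilbertOp.IsHilbertImage μ f.toHol (T f)) ∧
        (∀ f, HilbertOp.IsIntegralImage μ f.toHol (T f)) ∧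
        (∀ (α β : ℂ) (f g h : HilbertOp.CoreSpace γ),
          h.toHol = α • f.toHol + β • g.toHol → T h = α • T f + β • T g) ∧
        Continuous T ∧
        (1 ≤ γ → ∃ T' : HilbertOp.CoreSpace γ → HilbertOp.CoreSpace γ,
          (∀ f, (T' f).toHol = T f) ∧ Continuous T')) := by
  constructor
  · intro h
    -- Here `β = γ + 1/2`, which is exactly why the hull requires `s > γ + 1/2`; the core case uses
    -- `β = γ`.
    obtain ⟨h1, h2, h3, h4, A, hA0, hA⟩ := HilbertOp.hilbertOp_spec hμ (by linarith) h
      (X := HilbertOp.HullSpace γ) (HilbertOp.HullSpace.toHol) (K := 2 ^ γ)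
      (fun f => ⟨_, HilbertOp.blockBounded_of_hullNorm hγ.le (HilbertOp.hullNorm_ne_top hγ.le f.mem)⟩)
      (fun f g hfg => HilbertOp.blockBounded_of_hullNorm hγ.le hfg)
    refine ⟨_, h1, h2, h3, HilbertOp.continuous_holDisc_of_coeff hA, fun hγ2 => ?_⟩
    refine ⟨fun f => ⟨_, let ⟨_, hM⟩ := h4 f; HilbertOp.mem_solidHull_of_bounded hγ2 hM⟩,
      fun _ => rfl, HilbertOp.continuous_of_edist_le hA0 fun f g hfg => ?_⟩
    exact HilbertOp.hullNorm_le_of_bounded hγ2 (hA f g hfg)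
  · intro h
    obtain ⟨h1, h2, h3, h4, A, hA0, hA⟩ := HilbertOp.hilbertOp_spec hμ hγ h
      (X := HilbertOp.CoreSpace γ) (HilbertOp.CoreSpace.toHol) (K := 2 ^ γ)
      (fun f => ⟨_, HilbertOp.blockBounded_of_coreNorm hγ.le (HilbertOp.coreNorm_ne_top hγ.le f.mem)⟩)
      (fun f g hfg => HilbertOp.blockBounded_of_coreNorm hγ.le hfg)
    refine ⟨_, h1, h2, h3, HilbertOp.continuous_holDisc_of_coeff hA, fun hγ2 => ?_⟩
    refine ⟨fun f => ⟨_, let ⟨_, hM⟩ := h4 f; HilbertOp.mem_solidCore_of_bounded hγ2 hM⟩,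
      fun _ => rfl, HilbertOp.continuous_of_edist_le hA0 fun f g hfg => ?_⟩
    exact HilbertOp.coreNorm_le_of_bounded hγ2 (hA f g hfg)
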